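/- **Model.** There are $n$ nodes; node $v$ holds a value $x_v\in\{0,\dots,2^w-1\}$ with $w=O(\log n)$. In a uniform gossip algorithm all nodes act in synchronized rounds; in each round every node either pulls (it receives a message from a uniformly random node) or pushes (it sends a message to a uniformly random other node), all random choices being independent. The complexity is the number of rounds. A value $y$ has rank $r$ if $\#\{v: x_v<y\}<r\le\#\{v:x_v\le y\}$. In the $\epsilon$-approximate $\phi$-quantile problem every node has to output a value that has a rank $r$ with $(\phi-\epsilon)n\le r\le(\phi+\epsilon)n$. **Tournament algorithm** with parameters $\phi\in[0,1]$, $\epsilon\in(0,1/8]$, $K\in\mathbb N$. *Shifting phase (2-TOURNAMENT).* If $\phi-\epsilon\le 1-(\phi+\epsilon)$, let $h_0=1-(\phi+\epsilon)$ and $\mathrm{op}=\min$; otherwise let $h_0=\phi-\epsilon$ and $\mathrm{op}=\max$. Let $h_{i+1}=h_i^2$ and $T=\frac12-\epsilon$. For $i=0,1,\dots$, as long as $h_i>T$, do the following iteration with $\delta_i=\min\bigl(1,\frac{h_i-T}{h_i-h_{i+1}}\bigr)$: every node $v$ independently, with probability $\delta_i$, pulls the values of two random nodes $t_1(v),t_2(v)$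 and sets $x_v\leftarrow\mathrm{op}(x_{t_1(v)},x_{t_2(v)})$, and otherwise pulls the value of one random node $t_1(v)$ and sets $x_v\leftarrow x_{t_1(v)}$. (Each iteration is allotted two rounds.) *Median phase (3-TOURNAMENT, with accuracy $\epsilon/4$).* Let $l_0=\frac12-\frac\epsilon4$ and $l_{i+1}=3l_i^2-2l_i^3$. For $i=0,1,\dots$, as long as $l_i>n^{-1/3}$, every node pulls the values of three random nodes and sets $x_v$ to their median (three rounds). Finally every node pulls the values of $K$ random nodes and outputs their median. **Theorem.** There is an absolute constant $C>0$ such that for every $\gamma>0$ there is a constant $K$ with the following property. Let $\epsilon:\mathbb N\to(0,1]$ satisfy $\epsilon(n)=\Omega(n^{-0.096})$. Then for all sufficiently large $n$, every $\phi\in[0,1]$, every word length $w = O(\log n)$ and all initial values, the tournament algorithm with parameters $\phi$, $\min(\epsilon(n),\frac18)$ and $K$ is a uniform gossip algorithm that takes at most $C\bigl(\log\log n+\log\frac1{\epsilon(n)}\bigr)$ rounds, uses messages of $O(\log n)$ bits (if $w\le B\log n$, then at most $B\log n$ bits), and with probability at least $1-n^{-\gamma}$ solves the $\epsilon(n)$-approximate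 $\phi$-quantile problem, i.e. all nodes simultaneously output correct values. -/

import Mathlib

open scoped ENNReal NNReal

/-! ### Product of finitely many discrete distributions -/

theorem tsum_prod_fin {α : Type*} (n : ℕ) (g : Fin n → α → ℝ≥0∞) :
    ∑' f : Fin n → α, ∏ i, g i (f i) = ∏ i, ∑' a, g i a := by
  induction n with
  | zero => simp
  | succ n ih =>
    rw [← (Fin.consEquiv (fun _ : Fin (n + 1) => α)).tsum_eq
      (fun f : Fin (n + 1) → α => ∏ i, g i (f i)), ENNReal.tsum_prod', Fin.prod_univ_succ,
      ← ih (fun i => g i.succ), ← ENNReal.tsum_mul_right]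
    refine tsum_congr fun a => ?_
    rw [← ENNReal.tsum_mul_left]
    refine tsum_congr fun f => ?_
    simp [Fin.consEquiv, Fin.prod_univ_succ]

/-- The joint law of independent random variables with laws `p 0, …, p (n - 1)`. -/
noncomputable def indepPMF {α : Type*} {n : ℕ} (p : Fin n → PMF α) : PMF (Fin n → α) :=
  ⟨fun f => ∏ i, p i (f i), by
    have h : ∑' f : Fin n → α, ∏ i, p i (f i) = 1 := by
      rw [tsum_prod_fin]; simp [PMF.tsum_coe]
    exact h ▸ ENNReal.summable.hasSum⟩

/-- A biased coin: `true` with probability `p` (truncated to `[0, 1]`). -/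
noncomputable def coinPMF (p : ℝ) : PMF Bool :=
  PMF.ofFintype (fun b => cond b (ENNReal.ofReal (min 1 p)) (1 - ENNReal.ofReal (min 1 p))) (by
    simp)

/-! ### Uniform gossip algorithms -/

/-- A uniform gossip algorithm: a synchronous program, executed by every node of a complete
network. A message is a string of `messageBits` bits, represented by the number below
`2 ^ messageBits` that it encodes. Rounds are numbered `0, 1, …, rounds - 1`. -/
structure GossipAlgorithm (Input Output : Type) where
  /-- local states of a node -/
  State : Type
  /-- number of bits of a message -/
  messageBits : ℕ
  /-- number of communication rounds -/
  rounds : ℕ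
  /-- initial state of a node, from its own input -/
  init : Input → State
  /-- in round `r`, a node uses private randomness to update its state and to choose either
  to pull (`none`) or to push a message `m` (`some m`) -/
  act : ℕ → State → PMF (State × Option (Fin (2 ^ messageBits)))
  /-- the message that a node hands out in round `r` to the nodes that pull from it; it is
  determined by its state at the beginning of the round -/
  reply : ℕ → State → Fin (2 ^ messageBits)
  /-- state at the end of round `r`, from the state after `act`, the message pulled (if the node
  chose to pull) and the collection of messages that were pushed to the node -/
  receive : ℕ → State → Option (Fin (2 ^ messageBits)) →
    Multiset (Fin (2 ^ messageBits)) → State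
  /-- output of a node, from its state after the last round -/
  output : State → Output

/-- The node contacted by the node `v` that has chosen to pull (`none`) or to push (`some m`).
A pull contacts a uniformly random node. A push contacts a uniformly random other node
(in a network with a single node there is none, and the node contacts itself). -/
noncomputable def contactPMF {n : ℕ} {M : Type} (v : Fin n) : Option M → PMF (Fin n)
  | none => PMF.uniformOfFinset Finset.univ ⟨v, Finset.mem_univ v⟩
  | some _ =>
      if h : (Finset.univ.erase v).Nonempty then PMF.uniformOfFinset (Finset.univ.erase v) h
      else PMF.pure v

namespace GossipAlgorithm

variable {Input Output : Type}

/-- What node `v` with state `s` does in round `r`: new state, choice, and contacted node. -/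
noncomputable def choice (A : GossipAlgorithm Input Output) {n : ℕ} (r : ℕ) (v : Fin n)
    (s : A.State) : PMF (A.State × Option (Fin (2 ^ A.messageBits)) × Fin n) :=
  (A.act r s).bind fun a => (contactPMF v a.2).map fun u => (a.1, a.2, u)

/-- State of node `v` after round `r`, given the states `σ` of all nodes at the beginning of
the round and the choices `ω` of all nodes. -/
def deliver (A : GossipAlgorithm Input Output) {n : ℕ} (r : ℕ) (σ : Fin n → A.State)
    (ω : Fin n → A.State × Option (Fin (2 ^ A.messageBits)) × Fin n) (v : Fin n) : A.State :=
  A.receive r (ω v).1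
    (match (ω v).2.1 with
      | none => some (A.reply r (σ (ω v).2.2))
      | some _ => none)
    ((Finset.univ : Finset (Fin n)).val.filterMap fun u =>
      if (ω u).2.2 = v then (ω u).2.1 else none)

/-- One round: all nodes choose independently, then the messages are delivered. -/
noncomputable def step (A : GossipAlgorithm Input Output) {n : ℕ} (r : ℕ)
    (σ : Fin n → A.State) : PMF (Fin n → A.State) :=
  (indepPMF fun v => A.choice r v (σ v)).map (A.deliver r σ)

/-- Law of the states of the nodes `0, …, n - 1` with inputs `x` before round `r`. -/
noncomputable def config (A : GossipAlgorithm Input Output) {n : ℕ} (x : Fin n → Input) :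
    ℕ → PMF (Fin n → A.State)
  | 0 => PMF.pure fun v => A.init (x v)
  | r + 1 => (A.config x r).bind (A.step r)

/-- Joint law of the outputs of the nodes `0, …, n - 1` with inputs `x`. -/
noncomputable def outputs (A : GossipAlgorithm Input Output) {n : ℕ} (x : Fin n → Input) :
    PMF (Fin n → Output) :=
  (A.config x A.rounds).map fun σ v => A.output (σ v)

/-- Probability that the outputs of all nodes on inputs `x` jointly satisfy `P`. -/
noncomputable def prob (A : GossipAlgorithm Input Output) {n : ℕ} (x : Fin n → Input)
    (P : (Fin n → Output) → Prop) : ℝ :=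
  ((A.outputs x).toOuterMeasure {y | P y}).toReal

end GossipAlgorithm

/-! ### Quantiles -/

/-- The value `y` stands at position `r` (counted from `1`) when the values `x v` of the
nodes `v` are listed in nondecreasing order. Equal values occupy several positions. -/
def HasRank {α : Type*} [LinearOrder α] {n : ℕ} (x : Fin n → α) (y : α) (r : ℕ) : Prop :=
  (Finset.univ.filter fun v => x v < y).card < r ∧
    r ≤ (Finset.univ.filter fun v => x v ≤ y).card

/-- `y` is an `ε`-approximate `φ`-quantile of the values `x`: it has a rank between
`(φ - ε) n` and `(φ + ε) n`. -/
def IsApproxQuantile {α : Type*} [LinearOrder α] {n : ℕ} (x : Fin n → α) (φ ε : ℝ) (y : α) :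
    Prop :=
  ∃ r : ℕ, HasRank x y r ∧ (φ - ε) * n ≤ r ∧ (r : ℝ) ≤ (φ + ε) * n

/-! ### The tournament algorithm -/

/-- `h₀, h₀², h₀⁴, …`, the target sizes in the 2-tournaments. -/
def shiftSeq (h₀ : ℝ) : ℕ → ℝ
  | 0 => h₀
  | i + 1 => shiftSeq h₀ i ^ 2

/-- The target sizes in the 3-tournaments. -/
def medianSeq (l₀ : ℝ) : ℕ → ℝ
  | 0 => l₀
  | i + 1 => 3 * medianSeq l₀ i ^ 2 - 2 * medianSeq l₀ i ^ 3

/-- Whether the shifting phase shrinks the set of nodes with quantile above `φ + ε` by taking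
minima, because that set is the larger one. Otherwise it shrinks the set of nodes with quantile below
`φ - ε` by taking maxima. -/
def ShiftsByMin (φ ε : ℝ) : Prop := φ - ε ≤ 1 - (φ + ε)

open Classical in
/-- Initial target size of the set that the shifting phase shrinks. -/
noncomputable def shiftStart (φ ε : ℝ) : ℝ :=
  if ShiftsByMin φ ε then 1 - (φ + ε) else φ - ε

open Classical in
/-- Winner of a 2-tournament. -/
noncomputable def shiftOp {α : Type*} [LinearOrder α] (φ ε : ℝ) (a b : α) : α :=
  if ShiftsByMin φ ε then min a b else max a b

/-- Number of iterations of the shifting phase: it runs while `hᵢ > 1 / 2 - ε`. -/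
noncomputable def shiftIters (φ ε : ℝ) : ℕ :=
  sInf {i | shiftSeq (shiftStart φ ε) i ≤ 1 / 2 - ε}

/-- Probability with which a node plays the 2-tournament in iteration `i` of the shifting phase
(it is `1` in all iterations but possibly the last). -/
noncomputable def shiftProb (φ ε : ℝ) (i : ℕ) : ℝ :=
  min 1 ((shiftSeq (shiftStart φ ε) i - (1 / 2 - ε)) /
    (shiftSeq (shiftStart φ ε) i - shiftSeq (shiftStart φ ε) (i + 1)))

/-- Number of iterations of the median phase with accuracy `ε` on `n` nodes: it runs while
`lᵢ > n ^ (-1 / 3)`. -/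
noncomputable def medianIters (n : ℕ) (ε : ℝ) : ℕ :=
  sInf {i | medianSeq (1 / 2 - ε) i ≤ 1 / (n : ℝ) ^ (1 / 3 : ℝ)}

/-- The middle of three values. -/
def median3 {α : Type*} [LinearOrder α] (a b c : α) : α := max (min a b) (min (max a b) c)

/-- The median of a list of values (`d` if the list is empty). -/
def listMedian {α : Type*} [LinearOrder α] (l : List α) (d : α) : α :=
  (l.insertionSort (· ≤ ·)).getD (l.length / 2) d

/-- Local state in the tournament algorithm: current value, result of the last coin flip, and the
values pulled so far in the current iteration. -/
structure TournamentState (α : Type) where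
  val : α
  coin : Bool
  buf : List α

open Classical in
/-- The tournament algorithm for `n` nodes with values of `w` bits. In every round every node
pulls the current value of a random node.
* Shifting phase, with accuracy `ε`: each iteration takes two rounds. A node flips a coin, pulls
  two values, and keeps the winner of the 2-tournament between them, or simply the first of them,
  depending on the coin.
* Median phase, with accuracy `ε / 4`: each iteration takes three rounds. A node pulls three values
  and keeps the median of them.
* Finally, every node pulls `K` values and outputs their median. -/
noncomputable def tournament (n w : ℕ) (φ ε : ℝ) (K : ℕ) :
    GossipAlgorithm (Fin (2 ^ w)) (Fin (2 ^ w)) where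
  State := TournamentState (Fin (2 ^ w))
  messageBits := w
  rounds := 2 * shiftIters φ ε + 3 * medianIters n (ε / 4) + K
  init x := ⟨x, false, []⟩
  act r s :=
    if r < 2 * shiftIters φ ε ∧ r % 2 = 0 then
      (coinPMF (shiftProb φ ε (r / 2))).map fun b => (⟨s.val, b, s.buf⟩, none)
    else PMF.pure (s, none)
  reply _ s := s.val
  receive r s pulled _ :=
    if r < 2 * shiftIters φ ε then
      match s.buf, pulled with
      | [a], some b => ⟨if s.coin then shiftOp φ ε a b else a, s.coin, []⟩
      | l, m => ⟨s.val, s.coin, l ++ m.toList⟩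
    else if r < 2 * shiftIters φ ε + 3 * medianIters n (ε / 4) then
      match s.buf, pulled with
      | [a, b], some c => ⟨median3 a b c, s.coin, []⟩
      | l, m => ⟨s.val, s.coin, l ++ m.toList⟩
    else ⟨s.val, s.coin, s.buf ++ pulled.toList⟩
  output s := listMedian s.buf s.val

/-!
Call a value too high or too low if all its ranks are above `(φ + ε) n` or below `(φ - ε) n`. The
values that are too high form an upper set, those that are too low a lower set, and a value held
by a node initially that is in neither set is an `ε`-approximate `φ`-quantile
(`isApproxQuantile_of_notMem`). It suffices to bound the sizes of the two bad sets from above.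

Only pulls of the values held at the beginning of an iteration occur. Hence, given the
configuration before an iteration, the states of the nodes after it are independent
(`runFrom_eq_indepPMF`), and a node ends up in a bad set of relative size `p` with probability
* `δ p² + (1 - δ) p` in the shifting phase, if the set contains the winner of a 2-tournament only
  together with both participants,
* `δ (2 p - p²) + (1 - δ) p` in the shifting phase for the other bad set,
* `3 p² - 2 p³` in the median phase.

All these functions are increasing, so upper tails suffice, and a Chernoff bound
(`toOuterMeasure_indepPMF_card_le`) shows that, except with probability `exp (-n t² / 4)`, the set
exceeds its expected size by at most a fraction `t` of all nodes.

In the shifting phase the deviation from the ideal sizes at most doubles in each iteration, up to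
the new fluctuation `t` (`shift_and_step_le`, `shift_or_step_le`). As `2 ^ (number of iterations)`
is at most `2 / ε` (`two_pow_shiftIters_le`), the total deviation is `O(t / ε)`. The ideal size of
the shrinking set ends at `1 / 2 - ε`, and the ideal gap of `2 ε` between the two sets never
shrinks, so that both bad sets end with a fraction of at most `1 / 2 - ε / 2`. The median phase is
analysed with targets that start at `1 / 2 - ε / 4`; the initial relative slack below them absorbs
the fluctuations as long as a set is larger than `τ = n ^ (-1 / 10)` (`median_step_le`). At the
end both sets have size at most `τ n`, and the median of `K` samples is bad with probability
`O(√τ) ^ K` (`toOuterMeasure_samples_le`), which beats the union bound over the nodes for large `K`.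
Here `t = n ^ (-2 / 5)`, and the assumption on `ε` gives `ε ≥ n ^ (-1 / 10)`.
-/

/-! ### Product laws and events -/

section ProductLaw

variable {α β : Type*} {n : ℕ}

theorem indepPMF_apply (p : Fin n → PMF α) (f : Fin n → α) :
    indepPMF p f = ∏ i, p i (f i) := rfl

theorem mem_support_indepPMF {p : Fin n → PMF α} {f : Fin n → α}
    (hf : f ∈ (indepPMF p).support) (v : Fin n) : f v ∈ (p v).support := by
  rw [PMF.mem_support_iff, indepPMF_apply, Finset.prod_ne_zero_iff] at hf
  exact (PMF.mem_support_iff _ _).2 (hf v (Finset.mem_univ v))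

theorem indepPMF_pure (a : Fin n → α) : indepPMF (fun v => PMF.pure (a v)) = PMF.pure a := by
  classical
  ext f
  rw [indepPMF_apply, PMF.pure_apply]
  simp only [PMF.pure_apply]
  split_ifs with h
  · subst h; simp
  · obtain ⟨v, hv⟩ := Function.ne_iff.1 h
    exact Finset.prod_eq_zero (Finset.mem_univ v) (by simp [hv])

theorem bind_congr_of_mem_support {p : PMF α} {f g : α → PMF β}
    (h : ∀ a ∈ p.support, f a = g a) : p.bind f = p.bind g := by
  ext b
  rw [PMF.bind_apply, PMF.bind_apply]
  refine tsum_congr fun a => ?_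
  by_cases ha : p a = 0
  · simp [ha]
  · rw [h a ((PMF.mem_support_iff _ _).2 ha)]

/-- If the coordinates are independent and are then updated independently of each other, the
results are independent. -/
theorem indepPMF_bind (p : Fin n → PMF α) (q : Fin n → α → PMF β) :
    ((indepPMF p).bind fun f => indepPMF fun v => q v (f v)) =
      indepPMF fun v => (p v).bind (q v) := by
  ext g
  simp only [PMF.bind_apply, indepPMF_apply]
  rw [← tsum_prod_fin n (fun v a => p v a * q v a (g v))]
  exact tsum_congr fun f => Finset.prod_mul_distrib.symm

theorem indepPMF_map (p : Fin n → PMF α) (D : Fin n → α → β) :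
    ((indepPMF p).map fun f v => D v (f v)) = indepPMF fun v => (p v).map (D v) := by
  have := indepPMF_bind p (fun v a => PMF.pure (D v a))
  simp only [indepPMF_pure] at this
  exact this

theorem toOuterMeasure_indepPMF_coord (p : Fin n → PMF α) (v : Fin n) (S : Set α) :
    (indepPMF p).toOuterMeasure {f | f v ∈ S} = (p v).toOuterMeasure S := by
  classical
  rw [PMF.toOuterMeasure_apply, PMF.toOuterMeasure_apply]
  have h1 : ∀ f : Fin n → α, {f : Fin n → α | f v ∈ S}.indicator (indepPMF p) f =
      ∏ i, (if i = v then S.indicator (p v) else p i) (f i) := by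
    intro f
    by_cases hf : f v ∈ S
    · rw [Set.indicator_of_mem (show f ∈ {f : Fin n → α | f v ∈ S} from hf), indepPMF_apply]
      refine Finset.prod_congr rfl fun i _ => ?_
      split_ifs with h
      · subst h; rw [Set.indicator_of_mem hf]
      · rfl
    · rw [Set.indicator_of_notMem (show f ∉ {f : Fin n → α | f v ∈ S} from hf)]
      refine (Finset.prod_eq_zero (Finset.mem_univ v) ?_).symm
      simp [hf]
  rw [tsum_congr h1, tsum_prod_fin, Finset.prod_eq_single v]
  · simp
  · intro i _ hi
    simp [hi, PMF.tsum_coe]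
  · simp

theorem toOuterMeasure_indepPMF_exists_le (p : Fin n → PMF α) (S : Set α) (b : ℝ≥0∞)
    (h : ∀ v, (p v).toOuterMeasure S ≤ b) :
    (indepPMF p).toOuterMeasure {f | ∃ v, f v ∈ S} ≤ n * b := by
  have h1 : {f : Fin n → α | ∃ v, f v ∈ S} = ⋃ v, {f | f v ∈ S} := by ext; simp
  rw [h1]
  calc (indepPMF p).toOuterMeasure (⋃ v, {f | f v ∈ S})
      ≤ ∑ v, (indepPMF p).toOuterMeasure {f | f v ∈ S} := MeasureTheory.measure_iUnion_fintype_le _ _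
    _ ≤ ∑ _v : Fin n, b := Finset.sum_le_sum fun v _ => by
        rw [toOuterMeasure_indepPMF_coord]; exact h v
    _ = n * b := by simp

theorem toOuterMeasure_le_one (p : PMF α) (S : Set α) : p.toOuterMeasure S ≤ 1 := by
  rw [PMF.toOuterMeasure_apply, ← p.tsum_coe]
  exact ENNReal.tsum_le_tsum fun a => Set.indicator_le_self _ _ a

theorem toOuterMeasure_add_compl (p : PMF α) (S : Set α) :
    p.toOuterMeasure S + p.toOuterMeasure Sᶜ = 1 := by
  rw [PMF.toOuterMeasure_apply, PMF.toOuterMeasure_apply, ← ENNReal.tsum_add, ← p.tsum_coe]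
  exact tsum_congr fun a => Set.indicator_self_add_compl_apply _ _ a

/-- The failure probability of a two-stage experiment is at most that of the first stage plus
that of the second stage after a success in the first. -/
theorem toOuterMeasure_bind_le (p : PMF α) (f : α → PMF β) (I : Set α) (S : Set β) (η : ℝ≥0∞)
    (h : ∀ a ∈ I, (f a).toOuterMeasure S ≤ η) :
    (p.bind f).toOuterMeasure S ≤ p.toOuterMeasure Iᶜ + η := by
  rw [PMF.toOuterMeasure_bind_apply, PMF.toOuterMeasure_apply]
  calc ∑' a, p a * (f a).toOuterMeasure S
      ≤ ∑' a, (Iᶜ.indicator p a + p a * η) := by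
        refine ENNReal.tsum_le_tsum fun a => ?_
        by_cases ha : a ∈ I
        · exact le_add_left (by gcongr; exact h a ha)
        · rw [Set.indicator_of_mem (show a ∈ Iᶜ from ha)]
          exact le_add_right (mul_le_of_le_one_right' (toOuterMeasure_le_one _ _))
    _ = _ := by rw [ENNReal.tsum_add, ENNReal.tsum_mul_right, p.tsum_coe, one_mul]

/-- Moment generating function of the indicator of an event. -/
theorem tsum_mul_exp_indicator (p : PMF α) (S : Set α) [DecidablePred (· ∈ S)] {l : ℝ}
    (hl : 0 ≤ l) :
    ∑' a, p a * (if a ∈ S then ENNReal.ofReal (Real.exp l) else 1) =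
      1 + ENNReal.ofReal (Real.exp l - 1) * p.toOuterMeasure S := by
  have h1 : ENNReal.ofReal (Real.exp l) = 1 + ENNReal.ofReal (Real.exp l - 1) := by
    rw [← ENNReal.ofReal_one, ← ENNReal.ofReal_add zero_le_one
      (by linarith [Real.one_le_exp hl])]
    congr 1; ring
  rw [PMF.toOuterMeasure_apply, ← ENNReal.tsum_mul_left, ← p.tsum_coe, ← ENNReal.tsum_add]
  refine tsum_congr fun a => ?_
  by_cases ha : a ∈ S
  · simp only [ha, if_true, Set.indicator_of_mem]
    rw [h1, mul_add, mul_one, mul_comm (p a)]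
  · simp [ha]

open Classical in
/-- Chernoff bound for the number of independent coordinates that fall into `S`. Only the upper
tail is needed, and only an upper bound `q` on the individual probabilities. -/
theorem toOuterMeasure_indepPMF_card_le (p : Fin n → PMF α) (S : Set α) {q t : ℝ}
    (hq0 : 0 ≤ q) (hq1 : q ≤ 1) (ht0 : 0 ≤ t) (ht1 : t ≤ 1)
    (h : ∀ v, (p v).toOuterMeasure S ≤ ENNReal.ofReal q) :
    (indepPMF p).toOuterMeasure
        {f | (q + t) * n < ((Finset.univ.filter fun v => f v ∈ S).card : ℝ)} ≤
      ENNReal.ofReal (Real.exp (-(n * t ^ 2 / 4))) := by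
  -- The exponent `t / 2` is nearly optimal in Markov's inequality for the exponential.
  set l : ℝ := t / 2 with hl
  have hl0 : 0 ≤ l := by positivity
  set c : ℝ≥0∞ := ENNReal.ofReal (Real.exp (-(l * ((q + t) * n)))) with hc
  have hexp : Real.exp l - 1 ≤ l + l ^ 2 := by
    have := Real.exp_bound' (x := l) hl0 (by linarith) (n := 2) (by norm_num)
    norm_num [Finset.sum_range_succ] at this
    nlinarith [sq_nonneg l]
  have hexp0 : 0 ≤ Real.exp l - 1 := by linarith [Real.one_le_exp hl0]
  rw [PMF.toOuterMeasure_apply]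
  calc ∑' f, Set.indicator
        {f | (q + t) * n < ((Finset.univ.filter fun v => f v ∈ S).card : ℝ)} (indepPMF p) f
      ≤ ∑' f : Fin n → α,
          c * ∏ v, (p v (f v) * (if f v ∈ S then ENNReal.ofReal (Real.exp l) else 1)) := by
        refine ENNReal.tsum_le_tsum fun f => ?_
        rw [Finset.prod_mul_distrib, ← indepPMF_apply, Finset.prod_ite, Finset.prod_const,
          Finset.prod_const_one, mul_one, mul_left_comm]
        refine Set.indicator_apply_le' (fun hf => ?_) fun _ => zero_le
        refine le_mul_of_one_le_right' ?_
        rw [hc, ← ENNReal.ofReal_pow (Real.exp_nonneg _), ← Real.exp_nat_mul,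
          ← ENNReal.ofReal_mul (Real.exp_nonneg _), ← Real.exp_add, ENNReal.one_le_ofReal]
        refine Real.one_le_exp ?_
        have hf' : (q + t) * n < ((Finset.univ.filter fun v => f v ∈ S).card : ℝ) := hf
        nlinarith
    _ = c * ∏ v, (1 + ENNReal.ofReal (Real.exp l - 1) * (p v).toOuterMeasure S) := by
        rw [ENNReal.tsum_mul_left, tsum_prod_fin n
          (fun v a => p v a * (if a ∈ S then ENNReal.ofReal (Real.exp l) else 1))]
        congr 1
        exact Finset.prod_congr rfl fun v _ => tsum_mul_exp_indicator _ _ hl0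
    _ ≤ c * ∏ _v : Fin n, ENNReal.ofReal (Real.exp (q * (l + l ^ 2))) := by
        gcongr with v _
        calc 1 + ENNReal.ofReal (Real.exp l - 1) * (p v).toOuterMeasure S
            ≤ 1 + ENNReal.ofReal (Real.exp l - 1) * ENNReal.ofReal q := by gcongr; exact h v
          _ = ENNReal.ofReal (1 + (Real.exp l - 1) * q) := by
            rw [← ENNReal.ofReal_mul hexp0, ENNReal.ofReal_add zero_le_one (by positivity),
              ENNReal.ofReal_one]
          _ ≤ _ := by
            refine ENNReal.ofReal_le_ofReal ?_
            have := Real.add_one_le_exp (q * (l + l ^ 2))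
            nlinarith
    _ ≤ _ := by
        rw [Finset.prod_const, Finset.card_univ, Fintype.card_fin, hc,
          ← ENNReal.ofReal_pow (Real.exp_nonneg _), ← Real.exp_nat_mul,
          ← ENNReal.ofReal_mul (Real.exp_nonneg _), ← Real.exp_add]
        refine ENNReal.ofReal_le_ofReal (Real.exp_le_exp.2 ?_)
        have hn : (0 : ℝ) ≤ n := Nat.cast_nonneg n
        have : q * l ^ 2 ≤ l ^ 2 := mul_le_of_le_one_left (sq_nonneg _) hq1
        have h2 : (n : ℝ) * (q * l ^ 2) ≤ n * l ^ 2 := mul_le_mul_of_nonneg_left this hn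
        have h3 : -(l * ((q + t) * n)) + n * (q * (l + l ^ 2)) = n * (q * l ^ 2) - n * (l * t) := by
          ring
        rw [h3, hl] at *
        nlinarith

end ProductLaw

/-! ### Rounds of the tournament algorithm -/

section Rounds

variable {n w : ℕ} (φ ε : ℝ) (K : ℕ)

/-- `k` rounds of the network, starting with round `r` and states `σ`. -/
noncomputable def runFrom (r : ℕ) (σ : Fin n → TournamentState (Fin (2 ^ w))) :
    ℕ → PMF (Fin n → TournamentState (Fin (2 ^ w)))
  | 0 => PMF.pure σ
  | k + 1 => (runFrom r σ k).bind ((tournament n w φ ε K).step (r + k))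

theorem config_add (x : Fin n → Fin (2 ^ w)) (r k : ℕ) :
    (tournament n w φ ε K).config x (r + k) =
      PMF.bind ((tournament n w φ ε K).config x r) fun σ => runFrom φ ε K r σ k := by
  induction k with
  | zero => exact (PMF.bind_pure _).symm
  | succ k ih =>
    change PMF.bind ((tournament n w φ ε K).config x (r + k)) _ = _
    rw [ih]
    exact PMF.bind_bind _ _ _

variable [Nonempty (Fin n)]

/-- One round of the tournament algorithm at a single node in state `s`, when the current values
of the nodes are `x`. -/
noncomputable def localStep (r : ℕ) (x : Fin n → Fin (2 ^ w))
    (s : TournamentState (Fin (2 ^ w))) : PMF (TournamentState (Fin (2 ^ w))) :=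
  PMF.bind ((tournament n w φ ε K).act r s) fun a =>
    (PMF.uniformOfFintype (Fin n)).map fun u =>
      (tournament n w φ ε K).receive r a.1 (some (x u)) 0

/-- `k` rounds at a single node, starting with round `r`, when the values of the nodes remain
`x`. -/
noncomputable def localRun (r : ℕ) (x : Fin n → Fin (2 ^ w)) :
    ℕ → TournamentState (Fin (2 ^ w)) → PMF (TournamentState (Fin (2 ^ w)))
  | 0, s => PMF.pure s
  | k + 1, s => (localRun r x k s).bind (localStep φ ε K (r + k) x)

/-- Nobody pushes, hence the states after a round are independent given those before it. -/
theorem step_eq_indepPMF (r : ℕ) (σ : Fin n → TournamentState (Fin (2 ^ w))) :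
    (tournament n w φ ε K).step r σ =
      indepPMF fun v => localStep φ ε K r (fun u => (σ u).val) (σ v) := by
  have key := indepPMF_map (fun v => (tournament n w φ ε K).choice r v (σ v))
    (fun (_ : Fin n) o => (tournament n w φ ε K).receive r o.1
      (match o.2.1 with
        | none => some ((tournament n w φ ε K).reply r (σ o.2.2))
        | some _ => none) 0)
  refine Eq.trans (Eq.trans ?_ key) ?_
  · unfold GossipAlgorithm.step
    congr 1
    funext ω v
    simp only [GossipAlgorithm.deliver, tournament]
    cases (ω v).2.1 <;> rfl
  · congr 1
    funext v
    have hact : ∀ a ∈ ((tournament n w φ ε K).act r (σ v)).support, a.2 = none := by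
      intro a ha
      simp only [tournament] at ha
      split_ifs at ha
      · rw [PMF.support_map] at ha
        obtain ⟨b, -, rfl⟩ := ha
        rfl
      · exact congrArg Prod.snd (Set.mem_singleton_iff.1 ((PMF.support_pure _).subset ha))
    unfold GossipAlgorithm.choice localStep
    rw [PMF.map_bind]
    refine bind_congr_of_mem_support fun a ha => ?_
    rw [hact a ha, PMF.map_comp]
    rfl

/-- As long as no node changes its value, the nodes evolve independently over several rounds. -/
theorem runFrom_eq_indepPMF (r : ℕ) (σ : Fin n → TournamentState (Fin (2 ^ w))) (k : ℕ)
    (h : ∀ j < k, ∀ v, ∀ s ∈ (localRun φ ε K r (fun u => (σ u).val) j (σ v)).support,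
      s.val = (σ v).val) :
    runFrom φ ε K r σ k =
      indepPMF fun v => localRun φ ε K r (fun u => (σ u).val) k (σ v) := by
  induction k with
  | zero => exact (indepPMF_pure σ).symm
  | succ k ih =>
    have h1 := ih fun j hj => h j (by omega)
    refine Eq.trans ?_ (indepPMF_bind _ (fun _ => localStep φ ε K (r + k) (fun u => (σ u).val)))
    change (runFrom φ ε K r σ k).bind _ = _
    rw [h1]
    refine bind_congr_of_mem_support fun f hf => ?_
    rw [step_eq_indepPMF]
    have : (fun u => (f u).val) = fun u => (σ u).val :=
      funext fun u => h k (by omega) u _ (mem_support_indepPMF hf u)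
    rw [this]

variable (x : Fin n → Fin (2 ^ w)) {r : ℕ} (y : Fin (2 ^ w)) (c : Bool)

theorem localStep_shift_first (hr : r < 2 * shiftIters φ ε) (he : r % 2 = 0) :
    localStep φ ε K r x ⟨y, c, []⟩ = (coinPMF (shiftProb φ ε (r / 2))).bind fun b =>
      (PMF.uniformOfFintype (Fin n)).map fun u => ⟨y, b, [x u]⟩ := by
  simp [localStep, tournament, hr, he, PMF.bind_map, Function.comp_def]

theorem localStep_shift_second (hr : r < 2 * shiftIters φ ε) (he : r % 2 = 1)
    (z : Fin (2 ^ w)) :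
    localStep φ ε K r x ⟨y, c, [z]⟩ = (PMF.uniformOfFintype (Fin n)).map fun u =>
      ⟨if c then shiftOp φ ε z (x u) else z, c, []⟩ := by
  simp [localStep, tournament, hr, he, PMF.pure_bind]

theorem localStep_median (h1 : 2 * shiftIters φ ε ≤ r)
    (h2 : r < 2 * shiftIters φ ε + 3 * medianIters n (ε / 4)) (l : List (Fin (2 ^ w))) :
    localStep φ ε K r x ⟨y, c, l⟩ = (PMF.uniformOfFintype (Fin n)).map fun u =>
      match l with
      | [a, b] => ⟨median3 a b (x u), c, []⟩
      | l => ⟨y, c, l ++ [x u]⟩ := by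
  simp only [localStep, tournament, h1.not_gt, h2, false_and, if_false, if_true, PMF.pure_bind]
  congr 1
  funext u
  rcases l with _ | ⟨a, _ | ⟨b, _ | ⟨d, l⟩⟩⟩ <;> rfl

theorem localStep_final (h1 : 2 * shiftIters φ ε + 3 * medianIters n (ε / 4) ≤ r)
    (l : List (Fin (2 ^ w))) :
    localStep φ ε K r x ⟨y, c, l⟩ = (PMF.uniformOfFintype (Fin n)).map fun u =>
      ⟨y, c, l ++ [x u]⟩ := by
  have h2 : ¬ r < 2 * shiftIters φ ε := by omega
  simp [localStep, tournament, h1.not_gt, h2, PMF.pure_bind]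

theorem localRun_shift (hr : r < 2 * shiftIters φ ε) (he : r % 2 = 0) :
    localRun φ ε K r x 2 ⟨y, c, []⟩ = (coinPMF (shiftProb φ ε (r / 2))).bind fun b =>
      (PMF.uniformOfFintype (Fin n)).bind fun u₁ => (PMF.uniformOfFintype (Fin n)).map fun u₂ =>
        ⟨if b then shiftOp φ ε (x u₁) (x u₂) else x u₁, b, []⟩ := by
  have h1 : r + 1 < 2 * shiftIters φ ε := by omega
  have h2 : (r + 1) % 2 = 1 := by omega
  simp only [localRun, PMF.pure_bind, Nat.add_zero]
  rw [localStep_shift_first φ ε K x y c hr he, PMF.bind_bind]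
  congr 1; funext b
  rw [PMF.bind_map]
  congr 1; funext u
  exact localStep_shift_second φ ε K x y b h1 h2 (x u)

theorem localRun_median (h1 : 2 * shiftIters φ ε ≤ r)
    (h2 : r + 2 < 2 * shiftIters φ ε + 3 * medianIters n (ε / 4)) :
    localRun φ ε K r x 3 ⟨y, c, []⟩ =
      (PMF.uniformOfFintype (Fin n)).bind fun u₁ => (PMF.uniformOfFintype (Fin n)).bind fun u₂ =>
        (PMF.uniformOfFintype (Fin n)).map fun u₃ =>
          ⟨median3 (x u₁) (x u₂) (x u₃), c, []⟩ := by
  simp only [localRun, PMF.pure_bind, Nat.add_zero]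
  rw [localStep_median φ ε K x y c h1 (by omega), PMF.bind_map, PMF.bind_bind]
  congr 1; funext u
  simp only [Function.comp_apply, List.nil_append]
  rw [localStep_median φ ε K x y c (by omega) (by omega), PMF.bind_map]
  congr 1; funext u₂
  simp only [Function.comp_apply, List.cons_append, List.nil_append]
  rw [localStep_median φ ε K x y c (by omega) (by omega)]

/-- The list of `k` independent uniform samples from `x`. -/
noncomputable def samples : ℕ → PMF (List (Fin (2 ^ w)))
  | 0 => PMF.pure []
  | k + 1 => (samples k).bind fun l => (PMF.uniformOfFintype (Fin n)).map fun u => l ++ [x u]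

theorem localRun_final (h1 : 2 * shiftIters φ ε + 3 * medianIters n (ε / 4) ≤ r) (k : ℕ) :
    localRun φ ε K r x k ⟨y, c, []⟩ = (samples x k).map fun l => ⟨y, c, l⟩ := by
  induction k with
  | zero => simp [localRun, samples, PMF.pure_map]
  | succ k ih =>
    simp only [localRun, samples]
    rw [ih, PMF.bind_map, PMF.map_bind]
    congr 1; funext l
    simp only [Function.comp_apply]
    rw [localStep_final φ ε K x y c (by omega), PMF.map_comp]
    rfl

end Rounds

/-! ### Success probabilities of a single node -/

section Local

open Classical in
/-- Fraction of the nodes whose value lies in `P`. -/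
noncomputable def frac {α : Type*} {n : ℕ} (x : Fin n → α) (P : Set α) : ℝ :=
  ((Finset.univ.filter fun v => x v ∈ P).card : ℝ) / n

theorem frac_nonneg {α : Type*} {n : ℕ} (x : Fin n → α) (P : Set α) : 0 ≤ frac x P := by
  unfold frac; positivity

theorem frac_le_one {α : Type*} {n : ℕ} (x : Fin n → α) (P : Set α) : frac x P ≤ 1 := by
  classical
  unfold frac
  refine div_le_one_of_le₀ ?_ (Nat.cast_nonneg n)
  exact_mod_cast (Finset.card_le_univ _).trans_eq (Fintype.card_fin n)

open Classical in
theorem frac_eq_sum {α : Type*} {n : ℕ} (x : Fin n → α) (P : Set α) :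
    frac x P = (∑ u, if x u ∈ P then (1 : ℝ) else 0) / n := by
  simp [frac]

variable {β : Type*}

theorem toReal_bind_coin {δ : ℝ} (h0 : 0 ≤ δ) (h1 : δ ≤ 1) (f : Bool → PMF β) (S : Set β) :
    (((coinPMF δ).bind f).toOuterMeasure S).toReal =
      δ * ((f true).toOuterMeasure S).toReal + (1 - δ) * ((f false).toOuterMeasure S).toReal := by
  have ht : ∀ b, coinPMF δ b * (f b).toOuterMeasure S ≠ ⊤ := fun b =>
    ENNReal.mul_ne_top (PMF.apply_ne_top _ _)
      (ne_top_of_le_ne_top ENNReal.one_ne_top (toOuterMeasure_le_one _ _))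
  have h2 : ENNReal.ofReal δ ≤ 1 := by simpa using ENNReal.ofReal_le_ofReal h1
  rw [PMF.toOuterMeasure_bind_apply, tsum_fintype, Fintype.sum_bool,
    ENNReal.toReal_add (ht _) (ht _), ENNReal.toReal_mul, ENNReal.toReal_mul]
  simp [coinPMF, min_eq_right h1, ENNReal.toReal_sub_of_le h2, ENNReal.toReal_ofReal h0]

variable {n : ℕ} [Nonempty (Fin n)]

theorem toReal_bind_uniform (f : Fin n → PMF β) (S : Set β) :
    (((PMF.uniformOfFintype (Fin n)).bind f).toOuterMeasure S).toReal =
      (∑ u, ((f u).toOuterMeasure S).toReal) / n := by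
  rw [PMF.toOuterMeasure_bind_apply, tsum_fintype, ENNReal.toReal_sum]
  · rw [Finset.sum_div]
    refine Finset.sum_congr rfl fun u _ => ?_
    simp [ENNReal.toReal_mul, div_eq_inv_mul]
  · intro u _
    exact ENNReal.mul_ne_top (PMF.apply_ne_top _ _)
      (ne_top_of_le_ne_top ENNReal.one_ne_top (toOuterMeasure_le_one _ _))

open Classical in
theorem toReal_pure (b : β) (S : Set β) :
    ((PMF.pure b).toOuterMeasure S).toReal = if b ∈ S then 1 else 0 := by
  rw [PMF.toOuterMeasure_pure_apply]
  split_ifs <;> simp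

open Classical in
theorem toReal_map_uniform (f : Fin n → β) (S : Set β) :
    (((PMF.uniformOfFintype (Fin n)).map f).toOuterMeasure S).toReal =
      (∑ u, if f u ∈ S then (1 : ℝ) else 0) / n := by
  rw [PMF.map, toReal_bind_uniform]
  simp only [Function.comp_apply, toReal_pure]

end Local

section Blocks

variable {n w : ℕ} [Nonempty (Fin n)] (φ ε : ℝ) (K : ℕ) (x : Fin n → Fin (2 ^ w)) {r : ℕ}
  (y : Fin (2 ^ w)) (c : Bool) (P : Set (Fin (2 ^ w)))

/-- One iteration of the shifting phase, for a set that contains the winner of a 2-tournament if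
and only if it contains both participants. -/
theorem prob_localRun_shift_of_and (hr : r < 2 * shiftIters φ ε) (he : r % 2 = 0)
    (h0 : 0 ≤ shiftProb φ ε (r / 2)) (hP : ∀ a b, shiftOp φ ε a b ∈ P ↔ a ∈ P ∧ b ∈ P) :
    ((localRun φ ε K r x 2 ⟨y, c, []⟩).toOuterMeasure {s | s.val ∈ P}).toReal =
      shiftProb φ ε (r / 2) * frac x P ^ 2 + (1 - shiftProb φ ε (r / 2)) * frac x P := by
  classical
  have hn : (n : ℝ) ≠ 0 := by
    have : n ≠ 0 := by rintro rfl; exact (Classical.arbitrary (Fin 0)).elim0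
    exact_mod_cast this
  have hand : ∀ a b, (if shiftOp φ ε a b ∈ P then (1 : ℝ) else 0) =
      (if a ∈ P then 1 else 0) * (if b ∈ P then 1 else 0) := by
    intro a b
    by_cases ha : a ∈ P <;> by_cases hb : b ∈ P <;> simp [hP, ha, hb]
  rw [localRun_shift φ ε K x y c hr he, toReal_bind_coin h0 (min_le_left _ _)]
  simp only [toReal_bind_uniform, toReal_map_uniform, Set.mem_ofPred_eq, if_true,
    Bool.false_eq_true, if_false, hand, Finset.sum_const, Finset.card_univ, Fintype.card_fin,
    frac_eq_sum, ← Finset.mul_sum, ← Finset.sum_mul, nsmul_eq_mul, ← Finset.sum_div]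
  field_simp

/-- One iteration of the shifting phase, for a set that contains the winner of a 2-tournament if
and only if it contains one of the participants. -/
theorem prob_localRun_shift_of_or (hr : r < 2 * shiftIters φ ε) (he : r % 2 = 0)
    (h0 : 0 ≤ shiftProb φ ε (r / 2)) (hP : ∀ a b, shiftOp φ ε a b ∈ P ↔ a ∈ P ∨ b ∈ P) :
    ((localRun φ ε K r x 2 ⟨y, c, []⟩).toOuterMeasure {s | s.val ∈ P}).toReal =
      shiftProb φ ε (r / 2) * (2 * frac x P - frac x P ^ 2) +
        (1 - shiftProb φ ε (r / 2)) * frac x P := by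
  classical
  have hn : (n : ℝ) ≠ 0 := by
    have : n ≠ 0 := by rintro rfl; exact (Classical.arbitrary (Fin 0)).elim0
    exact_mod_cast this
  have hor : ∀ a b, (if shiftOp φ ε a b ∈ P then (1 : ℝ) else 0) =
      (if a ∈ P then 1 else 0) + (if b ∈ P then 1 else 0) -
        (if a ∈ P then 1 else 0) * (if b ∈ P then 1 else 0) := by
    intro a b
    by_cases ha : a ∈ P <;> by_cases hb : b ∈ P <;> simp [hP, ha, hb]
  rw [localRun_shift φ ε K x y c hr he, toReal_bind_coin h0 (min_le_left _ _)]
  simp only [toReal_bind_uniform, toReal_map_uniform, Set.mem_ofPred_eq, if_true,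
    Bool.false_eq_true, if_false, hor, Finset.sum_const, Finset.card_univ, Fintype.card_fin,
    frac_eq_sum, ← Finset.mul_sum, ← Finset.sum_mul, nsmul_eq_mul, ← Finset.sum_div,
    Finset.sum_add_distrib, Finset.sum_sub_distrib]
  field_simp
  ring

/-- One iteration of the median phase, for a set that contains the median of three values if and
only if it contains two of them. -/
theorem prob_localRun_median (h1 : 2 * shiftIters φ ε ≤ r)
    (h2 : r + 2 < 2 * shiftIters φ ε + 3 * medianIters n (ε / 4))
    (hP : ∀ a b c, median3 a b c ∈ P ↔ (a ∈ P ∧ b ∈ P) ∨ (a ∈ P ∧ c ∈ P) ∨ (b ∈ P ∧ c ∈ P)) :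
    ((localRun φ ε K r x 3 ⟨y, c, []⟩).toOuterMeasure {s | s.val ∈ P}).toReal =
      3 * frac x P ^ 2 - 2 * frac x P ^ 3 := by
  classical
  have hn : (n : ℝ) ≠ 0 := by
    have : n ≠ 0 := by rintro rfl; exact (Classical.arbitrary (Fin 0)).elim0
    exact_mod_cast this
  have hmaj : ∀ a b c, (if median3 a b c ∈ P then (1 : ℝ) else 0) =
      (if a ∈ P then 1 else 0) * (if b ∈ P then 1 else 0) +
      (if a ∈ P then 1 else 0) * (if c ∈ P then 1 else 0) +
      (if b ∈ P then 1 else 0) * (if c ∈ P then 1 else 0) -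
      2 * ((if a ∈ P then 1 else 0) * (if b ∈ P then 1 else 0) * (if c ∈ P then 1 else 0)) := by
    intro a b c
    by_cases ha : a ∈ P <;> by_cases hb : b ∈ P <;> by_cases hc : c ∈ P <;>
      norm_num [hP, ha, hb, hc]
  rw [localRun_median φ ε K x y c h1 h2]
  simp only [toReal_bind_uniform, toReal_map_uniform, Set.mem_ofPred_eq, hmaj, Finset.sum_const,
    Finset.card_univ, Fintype.card_fin, frac_eq_sum, ← Finset.mul_sum, ← Finset.sum_mul,
    nsmul_eq_mul, ← Finset.sum_div, Finset.sum_add_distrib, Finset.sum_sub_distrib]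
  field_simp
  ring

end Blocks

/-! ### The median of many samples -/

section Samples

theorem listMedian_mem_imp_upper {α : Type*} [LinearOrder α] {P : Set α} [DecidablePred (· ∈ P)]
    (hP : IsUpperSet P) {l : List α} (hl : 0 < l.length) {d : α} (h : listMedian l d ∈ P) :
    l.length ≤ 2 * l.countP (· ∈ P) := by
  set s := l.insertionSort (· ≤ ·) with hs
  have hperm : s.Perm l := List.perm_insertionSort _ _
  have hlen : s.length = l.length := hperm.length_eq
  have hsort : s.Pairwise (· ≤ ·) := List.pairwise_insertionSort _ _
  have hk : l.length / 2 < s.length := by omega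
  have hm : s[l.length / 2] ∈ P := by
    have : listMedian l d = s[l.length / 2] := by
      rw [listMedian, ← hs, List.getD_eq_getElem _ _ hk]
    rwa [← this]
  have hall : ∀ a ∈ s.drop (l.length / 2), a ∈ P := by
    rw [List.drop_eq_getElem_cons hk]
    intro a ha
    rcases List.mem_cons.1 ha with rfl | ha
    · exact hm
    · refine hP ?_ hm
      have h2 := hsort.drop (i := l.length / 2)
      rw [List.drop_eq_getElem_cons hk, List.pairwise_cons] at h2
      exact h2.1 a ha
  have h3 : (s.drop (l.length / 2)).countP (· ∈ P) = (s.drop (l.length / 2)).length :=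
    List.countP_eq_length.2 fun a ha => by simpa using hall a ha
  have h4 := (List.drop_sublist (l.length / 2) s).countP_le (p := fun a => decide (a ∈ P))
  rw [h3, List.length_drop, hperm.countP_eq] at h4
  omega

theorem listMedian_mem_imp_lower {α : Type*} [LinearOrder α] {P : Set α} [DecidablePred (· ∈ P)]
    (hP : IsLowerSet P) {l : List α} (hl : 0 < l.length) {d : α} (h : listMedian l d ∈ P) :
    l.length ≤ 2 * l.countP (· ∈ P) := by
  set s := l.insertionSort (· ≤ ·) with hs
  have hperm : s.Perm l := List.perm_insertionSort _ _
  have hlen : s.length = l.length := hperm.length_eq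
  have hsort : s.Pairwise (· ≤ ·) := List.pairwise_insertionSort _ _
  have hk : l.length / 2 < s.length := by omega
  have hm : s[l.length / 2] ∈ P := by
    have : listMedian l d = s[l.length / 2] := by
      rw [listMedian, ← hs, List.getD_eq_getElem _ _ hk]
    rwa [← this]
  have hall : ∀ a ∈ s.take (l.length / 2 + 1), a ∈ P := by
    intro a ha
    obtain ⟨i, hi, rfl⟩ := List.mem_take_iff_getElem.1 ha
    refine hP ?_ hm
    rcases (show i < l.length / 2 ∨ i = l.length / 2 by omega) with h1 | h1
    · exact List.pairwise_iff_getElem.1 hsort _ _ _ _ h1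
    · subst h1; exact le_rfl
  have h3 : (s.take (l.length / 2 + 1)).countP (· ∈ P) = (s.take (l.length / 2 + 1)).length :=
    List.countP_eq_length.2 fun a ha => by simpa using hall a ha
  have h4 := (List.take_sublist (l.length / 2 + 1) s).countP_le (p := fun a => decide (a ∈ P))
  rw [h3, List.length_take, hperm.countP_eq] at h4
  omega

theorem tsum_bind_mul {α β : Type*} (p : PMF α) (f : α → PMF β) (g : β → ℝ≥0∞) :
    ∑' b, (p.bind f) b * g b = ∑' a, p a * ∑' b, f a b * g b := by
  simp only [PMF.bind_apply, ← ENNReal.tsum_mul_right, ← ENNReal.tsum_mul_left]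
  rw [ENNReal.tsum_comm]
  simp only [mul_assoc]

theorem tsum_map_mul {α β : Type*} (p : PMF α) (f : α → β) (g : β → ℝ≥0∞) :
    ∑' b, (p.map f) b * g b = ∑' a, p a * g (f a) := by
  classical
  rw [PMF.map, tsum_bind_mul]
  refine tsum_congr fun a => ?_
  congr 1
  rw [tsum_eq_single (f a)]
  · simp
  · intro b hb
    simp [hb]

variable {n w : ℕ} [Nonempty (Fin n)] (x : Fin n → Fin (2 ^ w)) (P : Set (Fin (2 ^ w)))

theorem length_of_mem_support_samples (k : ℕ) {l : List (Fin (2 ^ w))}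
    (hl : l ∈ (samples x k).support) : l.length = k := by
  induction k generalizing l with
  | zero => simp [samples] at hl; simp [hl]
  | succ k ih =>
    simp only [samples, PMF.mem_support_bind_iff, PMF.mem_support_map_iff] at hl
    obtain ⟨l', hl', u, -, rfl⟩ := hl
    simp [ih hl']

theorem toOuterMeasure_uniform_eq_frac :
    (PMF.uniformOfFintype (Fin n)).toOuterMeasure {u | x u ∈ P} = ENNReal.ofReal (frac x P) := by
  classical
  have h := toReal_map_uniform x P
  rw [← frac_eq_sum, PMF.toOuterMeasure_map_apply] at h
  rw [← h, ENNReal.ofReal_toReal]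
  · rfl
  · exact ne_top_of_le_ne_top ENNReal.one_ne_top (toOuterMeasure_le_one _ _)

open Classical in
theorem tsum_samples_mul_pow_le {l : ℝ} (hl : 0 ≤ l) (h : Real.exp l * frac x P ≤ 1) (k : ℕ) :
    ∑' s, samples x k s * ENNReal.ofReal (Real.exp l) ^ s.countP (· ∈ P) ≤ 2 ^ k := by
  induction k with
  | zero =>
    rw [tsum_eq_single []]
    · simp [samples]
    · intro s hs
      simp [samples, hs]
  | succ k ih =>
    rw [samples, tsum_bind_mul]
    have h1 : ∀ s : List (Fin (2 ^ w)),
        ∑' b, ((PMF.uniformOfFintype (Fin n)).map fun u => s ++ [x u]) b *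
          ENNReal.ofReal (Real.exp l) ^ b.countP (· ∈ P) ≤
        ENNReal.ofReal (Real.exp l) ^ s.countP (· ∈ P) * 2 := by
      intro s
      rw [tsum_map_mul]
      have h2 : ∀ u, PMF.uniformOfFintype (Fin n) u *
          ENNReal.ofReal (Real.exp l) ^ (s ++ [x u]).countP (· ∈ P) =
          ENNReal.ofReal (Real.exp l) ^ s.countP (· ∈ P) * (PMF.uniformOfFintype (Fin n) u *
            (if u ∈ {u | x u ∈ P} then ENNReal.ofReal (Real.exp l) else 1)) := by
        intro u
        by_cases hu : x u ∈ P
        · simp only [List.countP_append, pow_add, hu, Set.mem_ofPred_eq, if_true,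
            List.countP_singleton, decide_true, pow_one]
          ring
        · simp only [List.countP_append, pow_add, hu, Set.mem_ofPred_eq, if_false,
            List.countP_singleton, decide_false, Bool.false_eq_true, pow_zero, mul_one]
          ring
      rw [tsum_congr h2, ENNReal.tsum_mul_left]
      gcongr
      rw [tsum_mul_exp_indicator _ _ hl, toOuterMeasure_uniform_eq_frac,
        ← ENNReal.ofReal_mul (by linarith [Real.one_le_exp hl])]
      refine le_of_le_of_eq (add_le_add_right (ENNReal.ofReal_le_one.2 ?_) 1) one_add_one_eq_two
      linarith [frac_nonneg x P]
    calc ∑' a, samples x k a * _ ≤ ∑' a, samples x k a *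
          (ENNReal.ofReal (Real.exp l) ^ a.countP (· ∈ P) * 2) :=
          ENNReal.tsum_le_tsum fun a => by gcongr; exact h1 a
      _ ≤ 2 ^ k * 2 := by
          simp only [← mul_assoc]
          rw [ENNReal.tsum_mul_right]
          gcongr
      _ = 2 ^ (k + 1) := (pow_succ _ _).symm

open Classical in
/-- If few values lie in `P`, then it is unlikely that half of `k` samples do. -/
theorem toOuterMeasure_samples_le {τ : ℝ} (h0 : 0 < τ) (h1 : τ ≤ 1) (h : frac x P ≤ τ) (k : ℕ) :
    (samples x k).toOuterMeasure {s | s.length ≤ 2 * s.countP (· ∈ P)} ≤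
      ENNReal.ofReal ((2 * √τ) ^ k) := by
  -- Markov's inequality for `τ⁻¹ ^ (number of samples in P)`, whose mean is at most `2 ^ k`.
  set l : ℝ := -Real.log τ with hl
  have hl0 : 0 ≤ l := by have := Real.log_nonpos h0.le h1; linarith
  have hexp : Real.exp l = τ⁻¹ := by rw [hl, Real.exp_neg, Real.exp_log h0]
  have hs : 0 < √τ := Real.sqrt_pos.2 h0
  have hsq : √τ ^ 2 = τ := Real.sq_sqrt h0.le
  have h2 := tsum_samples_mul_pow_le x P hl0 (by
    rw [hexp, inv_mul_le_iff₀ h0, mul_one]; exact h) k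
  rw [PMF.toOuterMeasure_apply]
  calc _ ≤ ∑' s, ENNReal.ofReal (√τ ^ k) *
        (samples x k s * ENNReal.ofReal (Real.exp l) ^ s.countP (· ∈ P)) := by
        refine ENNReal.tsum_le_tsum fun s => Set.indicator_apply_le' (fun hs' => ?_) fun _ => zero_le
        by_cases hsup : s ∈ (samples x k).support
        · rw [mul_left_comm]
          refine le_mul_of_one_le_right' ?_
          rw [← ENNReal.ofReal_pow (Real.exp_nonneg _), ← ENNReal.ofReal_mul (by positivity),
            ENNReal.one_le_ofReal, hexp]
          have hlen : k ≤ 2 * s.countP (· ∈ P) := by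
            have := length_of_mem_support_samples x k hsup
            rw [← this]; exact hs'
          calc (1 : ℝ) = τ ^ s.countP (· ∈ P) * τ⁻¹ ^ s.countP (· ∈ P) := by
                rw [← mul_pow, mul_inv_cancel₀ h0.ne', one_pow]
            _ = √τ ^ (2 * s.countP (· ∈ P)) * τ⁻¹ ^ s.countP (· ∈ P) := by rw [pow_mul, hsq]
            _ ≤ √τ ^ k * τ⁻¹ ^ s.countP (· ∈ P) := by
                gcongr ?_ * _
                exact pow_le_pow_of_le_one hs.le (Real.sqrt_le_one.2 h1) hlen
        · rw [(PMF.apply_eq_zero_iff _ _).2 hsup]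
          exact zero_le
    _ ≤ ENNReal.ofReal (√τ ^ k) * 2 ^ k := by
        rw [ENNReal.tsum_mul_left]; gcongr
    _ = _ := by
        rw [mul_pow, mul_comm, ENNReal.ofReal_mul (by positivity), ENNReal.ofReal_pow (by norm_num)]
        simp

end Samples

/-! ### Values that are too high or too low -/

section Quantiles

variable {α : Type*} [LinearOrder α] {n : ℕ}

/-- The values all of whose ranks exceed `(φ + ε) n`. -/
def tooHigh (x : Fin n → α) (φ ε : ℝ) : Set α :=
  {y | (φ + ε) * n < (Finset.univ.filter fun v => x v < y).card + 1}

/-- The values all of whose ranks are below `(φ - ε) n`. -/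
def tooLow (x : Fin n → α) (φ ε : ℝ) : Set α :=
  {y | ((Finset.univ.filter fun v => x v ≤ y).card : ℝ) < (φ - ε) * n}

theorem isUpperSet_tooHigh (x : Fin n → α) (φ ε : ℝ) : IsUpperSet (tooHigh x φ ε) := by
  intro a b hab ha
  have h : (Finset.univ.filter fun v => x v < a).card ≤ (Finset.univ.filter fun v => x v < b).card :=
    Finset.card_le_card (Finset.monotone_filter_right _ fun v _ hv => hv.trans_le hab)
  have h' : ((Finset.univ.filter fun v => x v < a).card : ℝ) ≤
    (Finset.univ.filter fun v => x v < b).card := by exact_mod_cast h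
  have ha' : (φ + ε) * n < (Finset.univ.filter fun v => x v < a).card + 1 := ha
  change (φ + ε) * n < (Finset.univ.filter fun v => x v < b).card + 1
  linarith

theorem isLowerSet_tooLow (x : Fin n → α) (φ ε : ℝ) : IsLowerSet (tooLow x φ ε) := by
  intro a b hab ha
  have h : (Finset.univ.filter fun v => x v ≤ b).card ≤ (Finset.univ.filter fun v => x v ≤ a).card :=
    Finset.card_le_card (Finset.monotone_filter_right _ fun v _ hv => le_trans hv hab)
  have h' : ((Finset.univ.filter fun v => x v ≤ b).card : ℝ) ≤
    (Finset.univ.filter fun v => x v ≤ a).card := by exact_mod_cast h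
  have ha' : ((Finset.univ.filter fun v => x v ≤ a).card : ℝ) < (φ - ε) * n := ha
  change ((Finset.univ.filter fun v => x v ≤ b).card : ℝ) < (φ - ε) * n
  linarith

theorem isApproxQuantile_of_notMem {x : Fin n → α} {φ ε : ℝ} {y : α} (hε : 1 ≤ 2 * ε * n)
    (hφε : 0 ≤ (φ + ε) * n) (hy : y ∈ Set.range x) (h1 : y ∉ tooHigh x φ ε)
    (h2 : y ∉ tooLow x φ ε) : IsApproxQuantile x φ ε y := by
  have h1' : ((Finset.univ.filter fun v => x v < y).card : ℝ) + 1 ≤ (φ + ε) * n := not_lt.1 h1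
  have h2' : (φ - ε) * n ≤ ((Finset.univ.filter fun v => x v ≤ y).card : ℝ) := not_lt.1 h2
  obtain ⟨v₀, rfl⟩ := hy
  have hlt : (Finset.univ.filter fun v => x v < x v₀).card <
      (Finset.univ.filter fun v => x v ≤ x v₀).card := by
    refine Finset.card_lt_card ⟨Finset.monotone_filter_right _ fun v _ hv => le_of_lt hv, ?_⟩
    intro h
    have := h (Finset.mem_filter.2 ⟨Finset.mem_univ v₀, le_rfl⟩)
    simp at this
  refine ⟨max ⌈(φ - ε) * n⌉₊ ((Finset.univ.filter fun v => x v < x v₀).card + 1),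
    ⟨lt_max_of_lt_right (Nat.lt_succ_self _), max_le (Nat.ceil_le.2 h2') hlt⟩, ?_, ?_⟩
  · exact (Nat.le_ceil _).trans (by exact_mod_cast le_max_left _ _)
  · rw [Nat.cast_max]
    refine max_le ?_ (by push_cast; exact h1')
    rcases le_or_gt 0 ((φ - ε) * n) with h | h
    · have := Nat.ceil_lt_add_one h
      nlinarith
    · rw [Nat.ceil_eq_zero.2 h.le]
      simpa using hφε

theorem IsApproxQuantile.mono {x : Fin n → α} {φ ε ε' : ℝ} {y : α} (h : ε ≤ ε')
    (hy : IsApproxQuantile x φ ε y) : IsApproxQuantile x φ ε' y := by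
  obtain ⟨r, hr, h1, h2⟩ := hy
  have hn : (0 : ℝ) ≤ n := Nat.cast_nonneg n
  exact ⟨r, hr, by nlinarith, by nlinarith⟩

theorem frac_tooHigh_le (x : Fin n → α) (φ ε : ℝ) (hn : 0 < n) :
    frac x (tooHigh x φ ε) ≤ max 0 (1 - (φ + ε)) + 1 / n := by
  classical
  have hn' : (0 : ℝ) < n := by exact_mod_cast hn
  unfold frac
  set H := Finset.univ.filter fun v => x v ∈ tooHigh x φ ε with hH
  rcases H.eq_empty_or_nonempty with h | h
  · rw [h]; simp only [Finset.card_empty, Nat.cast_zero, zero_div]; positivity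
  -- Below the smallest value that is too high there are only nodes outside of `H`.
  obtain ⟨v, hv, hmin⟩ := H.exists_min_image x h
  have hv' : (φ + ε) * n < (Finset.univ.filter fun u => x u < x v).card + 1 :=
    (Finset.mem_filter.1 hv).2
  have hsub : (Finset.univ.filter fun u => x u < x v) ⊆ Hᶜ := by
    intro u hu
    rw [Finset.mem_compl]
    exact fun h' => absurd (Finset.mem_filter.1 hu).2 (not_lt.2 (hmin u h'))
  have hcard := Finset.card_le_card hsub
  rw [Finset.card_compl, Fintype.card_fin] at hcard
  have hHn : H.card ≤ n := (Finset.card_le_univ _).trans_eq (Fintype.card_fin n)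
  have h3 : ((Finset.univ.filter fun u => x u < x v).card : ℝ) + H.card ≤ n := by
    exact_mod_cast (by omega)
  rw [div_le_iff₀ hn', add_mul, one_div, inv_mul_cancel₀ hn'.ne']
  have := mul_le_mul_of_nonneg_right (le_max_right 0 (1 - (φ + ε))) hn'.le
  nlinarith

theorem frac_tooLow_le (x : Fin n → α) (φ ε : ℝ) (hn : 0 < n) :
    frac x (tooLow x φ ε) ≤ max 0 (φ - ε) := by
  classical
  have hn' : (0 : ℝ) < n := by exact_mod_cast hn
  unfold frac
  set H := Finset.univ.filter fun v => x v ∈ tooLow x φ ε with hH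
  rcases H.eq_empty_or_nonempty with h | h
  · rw [h]; simp
  -- All values that are too low are at most the greatest of them.
  obtain ⟨v, hv, hmax⟩ := H.exists_max_image x h
  have hv' : ((Finset.univ.filter fun u => x u ≤ x v).card : ℝ) < (φ - ε) * n :=
    (Finset.mem_filter.1 hv).2
  have hsub : H ⊆ (Finset.univ.filter fun u => x u ≤ x v) := by
    intro u hu
    exact Finset.mem_filter.2 ⟨Finset.mem_univ _, hmax u hu⟩
  have hcard : (H.card : ℝ) ≤ (Finset.univ.filter fun u => x u ≤ x v).card := by
    exact_mod_cast Finset.card_le_card hsub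
  rw [div_le_iff₀ hn']
  have := mul_le_mul_of_nonneg_right (le_max_right 0 (φ - ε)) hn'.le
  linarith

theorem IsUpperSet.min_mem_iff {P : Set α} (hP : IsUpperSet P) (a b : α) :
    min a b ∈ P ↔ a ∈ P ∧ b ∈ P := by
  refine ⟨fun h => ⟨hP (min_le_left _ _) h, hP (min_le_right _ _) h⟩, fun h => ?_⟩
  rcases min_choice a b with h' | h' <;> rw [h']
  exacts [h.1, h.2]

theorem IsUpperSet.max_mem_iff {P : Set α} (hP : IsUpperSet P) (a b : α) :
    max a b ∈ P ↔ a ∈ P ∨ b ∈ P := by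
  refine ⟨fun h => ?_, fun h => h.elim (hP (le_max_left _ _)) (hP (le_max_right _ _))⟩
  rcases max_choice a b with h' | h' <;> rw [h'] at h
  exacts [Or.inl h, Or.inr h]

theorem IsLowerSet.max_mem_iff {P : Set α} (hP : IsLowerSet P) (a b : α) :
    max a b ∈ P ↔ a ∈ P ∧ b ∈ P := by
  refine ⟨fun h => ⟨hP (le_max_left _ _) h, hP (le_max_right _ _) h⟩, fun h => ?_⟩
  rcases max_choice a b with h' | h' <;> rw [h']
  exacts [h.1, h.2]

theorem IsLowerSet.min_mem_iff {P : Set α} (hP : IsLowerSet P) (a b : α) :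
    min a b ∈ P ↔ a ∈ P ∨ b ∈ P := by
  refine ⟨fun h => ?_, fun h => h.elim (hP (min_le_left _ _)) (hP (min_le_right _ _))⟩
  rcases min_choice a b with h' | h' <;> rw [h'] at h
  exacts [Or.inl h, Or.inr h]

theorem IsUpperSet.median3_mem_iff {P : Set α} (hP : IsUpperSet P) (a b c : α) :
    median3 a b c ∈ P ↔ (a ∈ P ∧ b ∈ P) ∨ (a ∈ P ∧ c ∈ P) ∨ (b ∈ P ∧ c ∈ P) := by
  rw [median3, hP.max_mem_iff, hP.min_mem_iff, hP.min_mem_iff, hP.max_mem_iff]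
  tauto

theorem IsLowerSet.median3_mem_iff {P : Set α} (hP : IsLowerSet P) (a b c : α) :
    median3 a b c ∈ P ↔ (a ∈ P ∧ b ∈ P) ∨ (a ∈ P ∧ c ∈ P) ∨ (b ∈ P ∧ c ∈ P) := by
  rw [median3, hP.max_mem_iff, hP.min_mem_iff, hP.min_mem_iff, hP.max_mem_iff]
  tauto

end Quantiles

/-! ### The target sizes in the shifting phase -/

section Shift

variable {φ ε : ℝ}

theorem shiftsByMin_iff : ShiftsByMin φ ε ↔ φ ≤ 1 / 2 := by
  unfold ShiftsByMin
  constructor <;> intro h <;> linarith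

theorem le_shiftStart : 1 / 2 - ε ≤ shiftStart φ ε := by
  unfold shiftStart
  split_ifs with h <;> rw [shiftsByMin_iff] at h <;> linarith

theorem shiftStart_le (h0 : 0 ≤ φ) (h1 : φ ≤ 1) : shiftStart φ ε ≤ 1 - ε := by
  unfold shiftStart
  split_ifs with h <;> linarith

theorem shiftSeq_eq_pow (h : ℝ) (i : ℕ) : shiftSeq h i = h ^ 2 ^ i := by
  induction i with
  | zero => simp [shiftSeq]
  | succ i ih => rw [shiftSeq, ih, ← pow_mul, pow_succ]

theorem shiftSeq_le_of_one_le (h0 : 0 ≤ φ) (h1 : φ ≤ 1) (hε0 : 0 < ε) (hε : ε ≤ 1 / 8) {i : ℕ}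
    (hi : 1 ≤ ε * 2 ^ i) : shiftSeq (shiftStart φ ε) i ≤ 1 / 2 - ε := by
  have hpos : 0 ≤ shiftStart φ ε := by
    have := le_shiftStart (φ := φ) (ε := ε); linarith
  have hle : shiftStart φ ε ≤ Real.exp (-ε) := by
    have := Real.add_one_le_exp (-ε)
    have := shiftStart_le (ε := ε) h0 h1
    linarith
  rw [shiftSeq_eq_pow]
  calc shiftStart φ ε ^ 2 ^ i ≤ Real.exp (-ε) ^ 2 ^ i := by gcongr
    _ = Real.exp (-(ε * 2 ^ i)) := by rw [← Real.exp_nat_mul]; push_cast; ring_nf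
    _ ≤ Real.exp (-1) := by gcongr
    _ ≤ 3 / 8 := by
      rw [Real.exp_neg, inv_le_comm₀ (Real.exp_pos 1) (by norm_num)]
      have := Real.exp_one_gt_d9
      norm_num; linarith
    _ ≤ 1 / 2 - ε := by linarith

theorem exists_one_le_mul_two_pow (hε0 : 0 < ε) : ∃ i : ℕ, 1 ≤ ε * 2 ^ i := by
  obtain ⟨i, hi⟩ := pow_unbounded_of_one_lt (1 / ε) (one_lt_two (α := ℝ))
  exact ⟨i, by rw [div_lt_iff₀ hε0] at hi; linarith⟩

theorem shiftSeq_shiftIters_le (h0 : 0 ≤ φ) (h1 : φ ≤ 1) (hε0 : 0 < ε) (hε : ε ≤ 1 / 8) :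
    shiftSeq (shiftStart φ ε) (shiftIters φ ε) ≤ 1 / 2 - ε := by
  obtain ⟨i, hi⟩ := exists_one_le_mul_two_pow hε0
  exact Nat.sInf_mem (s := {i | shiftSeq (shiftStart φ ε) i ≤ 1 / 2 - ε})
    ⟨i, shiftSeq_le_of_one_le h0 h1 hε0 hε hi⟩

theorem lt_shiftSeq_of_lt_shiftIters {i : ℕ} (hi : i < shiftIters φ ε) :
    1 / 2 - ε < shiftSeq (shiftStart φ ε) i :=
  not_le.1 (Nat.notMem_of_lt_sInf hi)

theorem two_pow_shiftIters_le (h0 : 0 ≤ φ) (h1 : φ ≤ 1) (hε0 : 0 < ε) (hε : ε ≤ 1 / 8) :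
    (2 : ℝ) ^ shiftIters φ ε ≤ 2 / ε := by
  rw [le_div_iff₀ hε0]
  rcases h : shiftIters φ ε with _ | k
  · norm_num; linarith
  · have hk := lt_shiftSeq_of_lt_shiftIters (φ := φ) (ε := ε) (i := k) (by omega)
    have : ¬ 1 ≤ ε * 2 ^ k := fun h' => absurd (shiftSeq_le_of_one_le h0 h1 hε0 hε h') hk.not_ge
    rw [pow_succ]
    linarith

/-- Fraction of the nodes that are expected in the shrinking set after `i` iterations of the
shifting phase. The last iteration ends exactly at the threshold `1 / 2 - ε`. -/
noncomputable def shiftTarget (φ ε : ℝ) (i : ℕ) : ℝ :=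
  if i < shiftIters φ ε then shiftSeq (shiftStart φ ε) i else 1 / 2 - ε

theorem shiftSeq_le_start (hε : ε ≤ 1 / 8) (hε0 : 0 < ε) (h0 : 0 ≤ φ) (h1 : φ ≤ 1) (i : ℕ) :
    shiftSeq (shiftStart φ ε) i ≤ 1 - ε := by
  have h2 := le_shiftStart (φ := φ) (ε := ε)
  have h3 := shiftStart_le (ε := ε) h0 h1
  rw [shiftSeq_eq_pow]
  exact (pow_le_of_le_one (by linarith) (by linarith) (by positivity)).trans h3

theorem shiftTarget_zero (h0 : 0 ≤ φ) (h1 : φ ≤ 1) (hε0 : 0 < ε) (hε : ε ≤ 1 / 8) :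
    shiftTarget φ ε 0 = shiftStart φ ε := by
  unfold shiftTarget
  split_ifs with h
  · rfl
  · have h2 := shiftSeq_shiftIters_le h0 h1 hε0 hε
    rw [show shiftIters φ ε = 0 by omega] at h2
    exact le_antisymm le_shiftStart h2

theorem le_shiftTarget (i : ℕ) : 1 / 2 - ε ≤ shiftTarget φ ε i := by
  unfold shiftTarget
  split_ifs with h
  · exact (lt_shiftSeq_of_lt_shiftIters h).le
  · exact le_rfl

theorem shiftTarget_le_one (h0 : 0 ≤ φ) (h1 : φ ≤ 1) (hε0 : 0 < ε) (hε : ε ≤ 1 / 8) (i : ℕ) :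
    shiftTarget φ ε i ≤ 1 := by
  unfold shiftTarget
  split_ifs with h
  · linarith [shiftSeq_le_start hε hε0 h0 h1 i]
  · linarith

theorem shiftProb_nonneg (h0 : 0 ≤ φ) (h1 : φ ≤ 1) (hε0 : 0 < ε) (hε : ε ≤ 1 / 8) {i : ℕ}
    (hi : i < shiftIters φ ε) : 0 ≤ shiftProb φ ε i := by
  have h2 := lt_shiftSeq_of_lt_shiftIters hi
  have h3 := shiftSeq_le_start hε hε0 h0 h1 i
  refine le_min zero_le_one (div_nonneg (by linarith) ?_)
  rw [shiftSeq]
  nlinarith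

theorem shiftTarget_succ (h0 : 0 ≤ φ) (h1 : φ ≤ 1) (hε0 : 0 < ε) (hε : ε ≤ 1 / 8) {i : ℕ}
    (hi : i < shiftIters φ ε) :
    shiftTarget φ ε (i + 1) =
      shiftProb φ ε i * shiftTarget φ ε i ^ 2 + (1 - shiftProb φ ε i) * shiftTarget φ ε i := by
  have h2 := lt_shiftSeq_of_lt_shiftIters hi
  have h3 := shiftSeq_le_start hε hε0 h0 h1 i
  have h4 : 0 < shiftSeq (shiftStart φ ε) i - shiftSeq (shiftStart φ ε) (i + 1) := by
    rw [shiftSeq]; nlinarith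
  have h5 : shiftSeq (shiftStart φ ε) i ^ 2 = shiftSeq (shiftStart φ ε) (i + 1) := rfl
  rw [shiftTarget, shiftTarget, if_pos hi, shiftProb]
  split_ifs with h
  · have h6 := lt_shiftSeq_of_lt_shiftIters h
    rw [min_eq_left (by rw [le_div_iff₀ h4]; linarith), h5]
    ring
  · have h6 := shiftSeq_shiftIters_le h0 h1 hε0 hε
    rw [show shiftIters φ ε = i + 1 by omega] at h6
    rw [min_eq_right (by rw [div_le_iff₀ h4]; linarith), h5]
    field_simp
    ring

/-- The deviation of the shrinking set from its target at most doubles in an iteration. -/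
theorem shift_and_step_le {δ p e E : ℝ} (hδ0 : 0 ≤ δ) (hδ1 : δ ≤ 1) (hp0 : 0 ≤ p) (hp1 : p ≤ 1)
    (he0 : 0 ≤ e) (he1 : e ≤ 1) (hE : 0 ≤ E) (h : p ≤ e + E) :
    δ * p ^ 2 + (1 - δ) * p ≤ δ * e ^ 2 + (1 - δ) * e + 2 * E := by
  have key : δ * p ^ 2 + (1 - δ) * p - (δ * e ^ 2 + (1 - δ) * e) =
      (p - e) * (δ * (p + e) + (1 - δ)) := by ring
  have h1 : 0 ≤ δ * (p + e) + (1 - δ) := by nlinarith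
  have h2 : δ * (p + e) + (1 - δ) ≤ 2 := by nlinarith
  nlinarith

/-- The same for the growing set. The target leaves a gap of at least `2 ε` between the two sets
unless the growing set is empty: the gap does not shrink while `2 e + 2 ε ≥ 1`. -/
theorem shift_or_step_le {δ p e E : ℝ} (hδ0 : 0 ≤ δ) (hδ1 : δ ≤ 1) (hp0 : 0 ≤ p) (hp1 : p ≤ 1)
    (hε0 : 0 < ε) (he0 : 1 / 2 - ε ≤ e) (he : 0 ≤ e) (hE : 0 ≤ E)
    (h : p ≤ max 0 (1 - e - 2 * ε) + E) :
    δ * (2 * p - p ^ 2) + (1 - δ) * p ≤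
      max 0 (1 - (δ * e ^ 2 + (1 - δ) * e) - 2 * ε) + 2 * E := by
  have hg1 : max 0 (1 - e - 2 * ε) ≤ 1 := max_le zero_le_one (by linarith)
  have hg0 : 0 ≤ max 0 (1 - e - 2 * ε) := le_max_left _ _
  have hstep : δ * (2 * max 0 (1 - e - 2 * ε) - max 0 (1 - e - 2 * ε) ^ 2) +
      (1 - δ) * max 0 (1 - e - 2 * ε) ≤ max 0 (1 - (δ * e ^ 2 + (1 - δ) * e) - 2 * ε) := by
    rcases le_total (1 - e - 2 * ε) 0 with h' | h'
    · rw [max_eq_left h']; simp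
    · rw [max_eq_right h']
      refine le_trans ?_ (le_max_right _ _)
      have : 0 ≤ δ * (2 * ε * (2 * e + 2 * ε - 1)) := by
        have : 0 ≤ 2 * e + 2 * ε - 1 := by linarith
        positivity
      nlinarith
  generalize max 0 (1 - e - 2 * ε) = g at *
  have key : δ * (2 * p - p ^ 2) + (1 - δ) * p - (δ * (2 * g - g ^ 2) + (1 - δ) * g) =
      (p - g) * (δ * (2 - (p + g)) + (1 - δ)) := by ring
  have h1 : 0 ≤ δ * (2 - (p + g)) + (1 - δ) := by nlinarith
  have h2 : δ * (2 - (p + g)) + (1 - δ) ≤ 2 := by nlinarith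
  nlinarith

end Shift

/-! ### The target sizes in the median phase -/

section Median

theorem cubic_mono {a b : ℝ} (h0 : 0 ≤ a) (h : a ≤ b) (h1 : b ≤ 1) :
    3 * a ^ 2 - 2 * a ^ 3 ≤ 3 * b ^ 2 - 2 * b ^ 3 := by
  have key : 3 * b ^ 2 - 2 * b ^ 3 - (3 * a ^ 2 - 2 * a ^ 3) =
      (b - a) * (2 * (a * (1 - a)) + 2 * (b * (1 - b)) + a * (1 - b) + b * (1 - a)) := by ring
  have h2 : 0 ≤ b - a := by linarith
  have h3 : 0 ≤ 1 - a := by linarith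
  have h4 : 0 ≤ 1 - b := by linarith
  have h5 : 0 ≤ b := h0.trans h
  have : 0 ≤ (b - a) * (2 * (a * (1 - a)) + 2 * (b * (1 - b)) + a * (1 - b) + b * (1 - a)) := by
    positivity
  linarith

theorem medianSeq_mem {l₀ : ℝ} (h0 : 0 ≤ l₀) (h1 : l₀ ≤ 1 / 2) (i : ℕ) :
    0 ≤ medianSeq l₀ i ∧ medianSeq l₀ i ≤ 1 / 2 := by
  induction i with
  | zero => exact ⟨h0, h1⟩
  | succ i ih =>
    obtain ⟨h2, h3⟩ := ih
    rw [medianSeq]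
    refine ⟨?_, ?_⟩
    · nlinarith [mul_nonneg (sq_nonneg (medianSeq l₀ i)) (sub_nonneg.2 h3)]
    · have := cubic_mono h2 h3 (by norm_num)
      norm_num at this ⊢
      linarith

/-- While a set is larger than `τ`, an initial relative slack `s` below the target sizes absorbs
the random fluctuations `t`. -/
theorem median_step_le {a l s t τ : ℝ} (ha0 : 0 ≤ a) (hl0 : 0 ≤ l) (hl1 : l ≤ 1 / 2)
    (hs0 : 0 ≤ s) (hs1 : s ≤ 1 / 2) (hτ : 0 ≤ τ) (hτ1 : 3 * τ ^ 2 + t ≤ τ)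
    (hτ2 : t ≤ τ ^ 2 * (s / 2)) (h : a ≤ max ((1 - s) * l) τ) :
    3 * a ^ 2 - 2 * a ^ 3 + t ≤ max ((1 - s) * (3 * l ^ 2 - 2 * l ^ 3)) τ := by
  rcases le_or_gt a τ with h1 | h1
  · refine le_trans ?_ (le_max_right _ _)
    have : a ^ 2 ≤ τ ^ 2 := by gcongr
    have : 0 ≤ a ^ 3 := by positivity
    linarith
  · refine le_trans ?_ (le_max_left _ _)
    have h2 : a ≤ (1 - s) * l := (le_max_iff.1 h).resolve_right h1.not_ge
    have hτl : τ ≤ l := by nlinarith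
    have h3 := cubic_mono ha0 h2 (by nlinarith)
    have h4 : τ ^ 2 * (s / 2) ≤ l ^ 2 * (s * (1 - s)) := by
      have : s / 2 ≤ s * (1 - s) := by nlinarith
      gcongr
    -- The relative slack is preserved with `l² s (1 - s) (3 - 4 l + 2 l s)` to spare.
    have h5 : (1 - s) * (3 * l ^ 2 - 2 * l ^ 3) -
        (3 * ((1 - s) * l) ^ 2 - 2 * ((1 - s) * l) ^ 3) =
        l ^ 2 * (s * (1 - s)) * (3 - 4 * l + 2 * l * s) := by ring
    have h6 : 0 ≤ l ^ 2 * (s * (1 - s)) := by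
      have : 0 ≤ 1 - s := by linarith
      positivity
    have h7 : 1 ≤ 3 - 4 * l + 2 * l * s := by nlinarith
    nlinarith

theorem medianSeq_le_sub_min {ε : ℝ} (h0 : 0 ≤ ε) (h1 : ε ≤ 1 / 4) (i : ℕ) :
    medianSeq (1 / 2 - ε) i ≤ 1 / 2 - min (1 / 4) ((11 / 8) ^ i * ε) := by
  induction i with
  | zero =>
    rw [medianSeq, pow_zero, one_mul]
    linarith [min_le_right (1 / 4) ε]
  | succ i ih =>
    have h2 := (medianSeq_mem (l₀ := 1 / 2 - ε) (by linarith) (by linarith) i).1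
    set g := min (1 / 4) ((11 / 8) ^ i * ε) with hg
    have hg0 : 0 ≤ g := le_min (by norm_num) (by positivity)
    have hg1 : g ≤ 1 / 4 := min_le_left _ _
    have h3 := cubic_mono h2 ih (by linarith)
    rw [medianSeq]
    have h4 : 3 * (1 / 2 - g) ^ 2 - 2 * (1 / 2 - g) ^ 3 = 1 / 2 - (3 / 2 * g - 2 * g ^ 3) := by ring
    have h5 : 11 / 8 * g ≤ 3 / 2 * g - 2 * g ^ 3 := by
      have : g ^ 2 ≤ (1 / 4) ^ 2 := by gcongr
      nlinarith
    have h6 : min (1 / 4) ((11 / 8) ^ (i + 1) * ε) ≤ 11 / 8 * g := by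
      rw [hg, mul_min_of_nonneg _ _ (by norm_num : (0 : ℝ) ≤ 11 / 8), pow_succ]
      exact min_le_min (by norm_num) (by linarith)
    linarith

theorem three_mul_medianSeq_le {l₀ : ℝ} (h0 : 0 ≤ l₀) (h1 : l₀ ≤ 1 / 2) {j : ℕ}
    (h : medianSeq l₀ j ≤ 1 / 4) (i : ℕ) : 3 * medianSeq l₀ (j + i) ≤ (3 / 4) ^ 2 ^ i := by
  induction i with
  | zero => norm_num; linarith
  | succ i ih =>
    have h2 := (medianSeq_mem h0 h1 (j + i)).1
    rw [← Nat.add_assoc, medianSeq, pow_succ 2, pow_mul]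
    have h3 : (3 * medianSeq l₀ (j + i)) ^ 2 ≤ ((3 / 4) ^ 2 ^ i) ^ 2 := by gcongr
    have h4 : 0 ≤ medianSeq l₀ (j + i) ^ 3 := by positivity
    linarith

theorem medianSeq_le_of_le {n i j : ℕ} {ε : ℝ} (h0 : 0 ≤ ε) (h1 : ε ≤ 1 / 4)
    (hi : 1 / 4 ≤ (11 / 8) ^ i * ε) (hj : (3 / 4 : ℝ) ^ 2 ^ j ≤ 1 / (n : ℝ) ^ (1 / 3 : ℝ)) :
    medianSeq (1 / 2 - ε) (i + j) ≤ 1 / (n : ℝ) ^ (1 / 3 : ℝ) := by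
  have h2 := medianSeq_le_sub_min h0 h1 i
  rw [min_eq_left hi] at h2
  have h3 := three_mul_medianSeq_le (by linarith) (by linarith) (j := i) (l₀ := 1 / 2 - ε)
    (by linarith) j
  have h4 := (medianSeq_mem (l₀ := 1 / 2 - ε) (by linarith) (by linarith) (i + j)).1
  linarith

end Median

/-! ### Concentration over the phases -/

section Phases

variable {n w : ℕ}

theorem listMedian_mem_range {x : Fin n → Fin (2 ^ w)} {l : List (Fin (2 ^ w))}
    {d : Fin (2 ^ w)} (hd : d ∈ Set.range x)
    (hl : ∀ b ∈ l, b ∈ Set.range x) : listMedian l d ∈ Set.range x := by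
  unfold listMedian
  by_cases h : l.length / 2 < (l.insertionSort (· ≤ ·)).length
  · rw [List.getD_eq_getElem _ _ h]
    exact hl _ ((List.perm_insertionSort _ _).mem_iff.1 (List.getElem_mem h))
  · rw [List.getD_eq_default _ _ (not_lt.1 h)]
    exact hd

/-- The configurations at the end of an iteration in which at most a fraction `a` of the values
lies in `P` and at most a fraction `b` in `Q`. -/
def sparse (n : ℕ) {w : ℕ} (P Q : Set (Fin (2 ^ w))) (a b : ℝ) :
    Set (Fin n → TournamentState (Fin (2 ^ w))) :=
  {σ | (∀ v, (σ v).buf = []) ∧ frac (fun v => (σ v).val) P ≤ a ∧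
    frac (fun v => (σ v).val) Q ≤ b}

/-- The bound for the probability that the size of one set exceeds its mean by a fraction `t` of
all nodes. -/
noncomputable def tailBound (n : ℕ) (t : ℝ) : ℝ≥0∞ :=
  ENNReal.ofReal (Real.exp (-(n * t ^ 2 / 4)))

theorem toOuterMeasure_indepPMF_compl_sparse_le (p : Fin n → PMF (TournamentState (Fin (2 ^ w))))
    (P Q : Set (Fin (2 ^ w))) {a b t : ℝ} (hn : 0 < n) (ht0 : 0 ≤ t) (ht1 : t ≤ 1)
    (hbuf : ∀ v, ∀ s ∈ (p v).support, s.buf = [])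
    (ha : ∃ q, 0 ≤ q ∧ q ≤ 1 ∧ q + t ≤ a ∧
      ∀ v, ((p v).toOuterMeasure {s | s.val ∈ P}).toReal = q)
    (hb : ∃ q, 0 ≤ q ∧ q ≤ 1 ∧ q + t ≤ b ∧
      ∀ v, ((p v).toOuterMeasure {s | s.val ∈ Q}).toReal = q) :
    (indepPMF p).toOuterMeasure (sparse n P Q a b)ᶜ ≤ 2 * tailBound n t := by
  classical
  have hn' : (0 : ℝ) < n := by exact_mod_cast hn
  have key : ∀ (R : Set (Fin (2 ^ w))) (c : ℝ), (∃ q, 0 ≤ q ∧ q ≤ 1 ∧ q + t ≤ c ∧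
      ∀ v, ((p v).toOuterMeasure {s | s.val ∈ R}).toReal = q) →
      (indepPMF p).toOuterMeasure {f | c < frac (fun v => (f v).val) R} ≤ tailBound n t := by
    rintro R c ⟨q, hq0, hq1, hqc, hq⟩
    refine le_trans (MeasureTheory.measure_mono ?_)
      (toOuterMeasure_indepPMF_card_le p {s | s.val ∈ R} hq0 hq1 ht0 ht1 fun v => ?_)
    · intro f hf
      have hf' : c < frac (fun v => (f v).val) R := hf
      have h2 := hqc.trans_lt hf'
      unfold frac at h2
      rw [lt_div_iff₀ hn'] at h2
      exact h2
    · rw [← hq v, ENNReal.ofReal_toReal]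
      exact ne_top_of_le_ne_top ENNReal.one_ne_top (toOuterMeasure_le_one _ _)
  have hsub : (sparse n P Q a b)ᶜ ∩ (indepPMF p).support ⊆
      {f | a < frac (fun v => (f v).val) P} ∪ {f | b < frac (fun v => (f v).val) Q} := by
    rintro f ⟨hf, hs⟩
    by_contra h
    rw [Set.mem_union, not_or] at h
    exact hf ⟨fun v => hbuf v _ (mem_support_indepPMF hs v), not_lt.1 h.1, not_lt.1 h.2⟩
  calc (indepPMF p).toOuterMeasure (sparse n P Q a b)ᶜ
      ≤ (indepPMF p).toOuterMeasure
        ({f | a < frac (fun v => (f v).val) P} ∪ {f | b < frac (fun v => (f v).val) Q}) :=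
        PMF.toOuterMeasure_mono _ hsub
    _ ≤ _ := MeasureTheory.measure_union_le _ _
    _ ≤ tailBound n t + tailBound n t := add_le_add (key P a ha) (key Q b hb)
    _ = _ := (two_mul _).symm

theorem toReal_toOuterMeasure_mem {α : Type*} (p : PMF α) (S : Set α) :
    0 ≤ (p.toOuterMeasure S).toReal ∧ (p.toOuterMeasure S).toReal ≤ 1 :=
  ⟨ENNReal.toReal_nonneg, by
    simpa using ENNReal.toReal_mono ENNReal.one_ne_top (toOuterMeasure_le_one p S)⟩

variable (φ ε : ℝ) (K : ℕ)

theorem receive_mem (r : ℕ) (s : TournamentState (Fin (2 ^ w))) {z : Fin (2 ^ w)}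
    {X : Set (Fin (2 ^ w))} (hval : s.val ∈ X) (hbuf : ∀ b ∈ s.buf, b ∈ X) (hu : z ∈ X) :
    TournamentState.val ((tournament n w φ ε K).receive r s (some z) 0) ∈ X ∧
      ∀ b ∈ TournamentState.buf ((tournament n w φ ε K).receive r s (some z) 0), b ∈ X := by
  obtain ⟨y, c, l⟩ := s
  have happ : ∀ b ∈ l ++ [z], b ∈ X := by
    intro b hb
    rcases List.mem_append.1 hb with hb | hb
    · exact hbuf b hb
    · rw [List.mem_singleton.1 hb]; exact hu
  have hnil : ∀ b ∈ ([] : List (Fin (2 ^ w))), b ∈ X :=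
    fun b hb => absurd hb List.not_mem_nil
  by_cases h1 : r < 2 * shiftIters φ ε
  · simp only [tournament, h1, if_true]
    rcases l with _ | ⟨a', _ | ⟨b', l⟩⟩
    · exact ⟨hval, happ⟩
    · refine ⟨?_, hnil⟩
      have ha := hbuf a' (by simp)
      simp only [shiftOp]
      split_ifs
      · rcases min_choice a' z with h | h <;> rw [h] <;> assumption
      · rcases max_choice a' z with h | h <;> rw [h] <;> assumption
      · exact ha
    · exact ⟨hval, happ⟩
  · by_cases h2 : r < 2 * shiftIters φ ε + 3 * medianIters n (ε / 4)
    · simp only [tournament, h1, h2, if_true, if_false]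
      rcases l with _ | ⟨a', _ | ⟨b', _ | ⟨d', l⟩⟩⟩
      · exact ⟨hval, happ⟩
      · exact ⟨hval, happ⟩
      · refine ⟨?_, hnil⟩
        have ha := hbuf a' (by simp)
        have hb := hbuf b' (by simp)
        have hmin : ∀ p q : Fin (2 ^ w), p ∈ X → q ∈ X →
            min p q ∈ X := fun p q hp hq => by
          rcases min_choice p q with h | h <;> rw [h] <;> assumption
        have hmax : ∀ p q : Fin (2 ^ w), p ∈ X → q ∈ X →
            max p q ∈ X := fun p q hp hq => by
          rcases max_choice p q with h | h <;> rw [h] <;> assumption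
        exact hmax _ _ (hmin _ _ ha hb) (hmin _ _ (hmax _ _ ha hb) hu)
      · exact ⟨hval, happ⟩
    · simp only [tournament, h1, h2, if_false]
      exact ⟨hval, happ⟩

variable [Nonempty (Fin n)] {P Q : Set (Fin (2 ^ w))} {t : ℝ}

/-- An iteration of the shifting phase that is started with few values in `P` and `Q`. -/
theorem shift_iteration (h0 : 0 ≤ φ) (h1 : φ ≤ 1) (hε0 : 0 < ε) (hε : ε ≤ 1 / 8)
    (ht0 : 0 ≤ t) (ht1 : t ≤ 1) (hP : ∀ a b, shiftOp φ ε a b ∈ P ↔ a ∈ P ∧ b ∈ P)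
    (hQ : ∀ a b, shiftOp φ ε a b ∈ Q ↔ a ∈ Q ∨ b ∈ Q) {i : ℕ} (hi : i < shiftIters φ ε)
    {E : ℝ} (hE : 0 ≤ E) {σ : Fin n → TournamentState (Fin (2 ^ w))}
    (hσ : σ ∈ sparse n P Q (shiftTarget φ ε i + E)
      (max 0 (1 - shiftTarget φ ε i - 2 * ε) + E)) :
    (runFrom φ ε K (2 * i) σ 2).toOuterMeasure
      (sparse n P Q (shiftTarget φ ε (i + 1) + (2 * E + t))
        (max 0 (1 - shiftTarget φ ε (i + 1) - 2 * ε) + (2 * E + t)))ᶜ ≤ 2 * tailBound n t := by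
  have hn : 0 < n := Fin.pos (Classical.arbitrary (Fin n))
  obtain ⟨hbuf, hσP, hσQ⟩ := hσ
  have hr : 2 * i < 2 * shiftIters φ ε := by omega
  have he : 2 * i % 2 = 0 := by omega
  have hdiv : 2 * i / 2 = i := by omega
  have hσv : ∀ v, σ v = ⟨(σ v).val, (σ v).coin, []⟩ := fun v => by rw [← hbuf v]
  have hδ0 := shiftProb_nonneg h0 h1 hε0 hε hi
  have hδ1 : shiftProb φ ε i ≤ 1 := min_le_left _ _
  have hT := le_shiftTarget (φ := φ) (ε := ε) i
  have hT1 := shiftTarget_le_one h0 h1 hε0 hε i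
  have hsucc := shiftTarget_succ h0 h1 hε0 hε hi
  rw [runFrom_eq_indepPMF]
  · refine toOuterMeasure_indepPMF_compl_sparse_le _ P Q hn ht0 ht1 ?_ ?_ ?_
    · intro v s hs
      rw [hσv v, localRun_shift φ ε K _ _ _ hr he] at hs
      simp only [PMF.mem_support_bind_iff, PMF.mem_support_map_iff] at hs
      obtain ⟨b, -, u₁, -, u₂, -, rfl⟩ := hs
      rfl
    · have hprob := fun v => prob_localRun_shift_of_and φ ε K (fun u => (σ u).val) (σ v).val
        (σ v).coin P hr he (by rwa [hdiv]) hP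
      simp only [← hσv, hdiv] at hprob
      refine ⟨_, ?_, ?_, ?_, hprob⟩
      · rw [← hprob (Classical.arbitrary _)]; exact (toReal_toOuterMeasure_mem _ _).1
      · rw [← hprob (Classical.arbitrary _)]; exact (toReal_toOuterMeasure_mem _ _).2
      · have := shift_and_step_le hδ0 hδ1 (frac_nonneg (fun u => (σ u).val) P) (frac_le_one _ _)
          (by linarith) hT1 hE hσP
        rw [hsucc]
        linarith
    · have hprob := fun v => prob_localRun_shift_of_or φ ε K (fun u => (σ u).val) (σ v).val
        (σ v).coin Q hr he (by rwa [hdiv]) hQ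
      simp only [← hσv, hdiv] at hprob
      refine ⟨_, ?_, ?_, ?_, hprob⟩
      · rw [← hprob (Classical.arbitrary _)]; exact (toReal_toOuterMeasure_mem _ _).1
      · rw [← hprob (Classical.arbitrary _)]; exact (toReal_toOuterMeasure_mem _ _).2
      · have := shift_or_step_le hδ0 hδ1 (frac_nonneg (fun u => (σ u).val) Q) (frac_le_one _ _)
          hε0 hT (by linarith) hE hσQ
        rw [hsucc]
        linarith
  · intro j hj v s hs
    rw [hσv v] at hs ⊢
    interval_cases j
    · simp only [localRun, PMF.mem_support_pure_iff] at hs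
      rw [hs]
    · simp only [localRun, PMF.pure_bind, Nat.add_zero] at hs
      rw [localStep_shift_first φ ε K _ _ _ hr he] at hs
      simp only [PMF.mem_support_bind_iff, PMF.mem_support_map_iff] at hs
      obtain ⟨b, -, u₁, -, rfl⟩ := hs
      rfl

/-- An iteration of the median phase that is started with few values in `P` and `Q`. -/
theorem median_iteration (hε0 : 0 ≤ ε) (hε : ε ≤ 1 / 2) (ht0 : 0 ≤ t) (ht1 : t ≤ 1)
    (hP : ∀ a b c, median3 a b c ∈ P ↔ (a ∈ P ∧ b ∈ P) ∨ (a ∈ P ∧ c ∈ P) ∨ (b ∈ P ∧ c ∈ P))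
    (hQ : ∀ a b c, median3 a b c ∈ Q ↔ (a ∈ Q ∧ b ∈ Q) ∨ (a ∈ Q ∧ c ∈ Q) ∨ (b ∈ Q ∧ c ∈ Q))
    {s τ : ℝ} (hs0 : 0 ≤ s) (hs1 : s ≤ 1 / 2) (hτ : 0 ≤ τ) (hτ1 : 3 * τ ^ 2 + t ≤ τ)
    (hτ2 : t ≤ τ ^ 2 * (s / 2)) {j : ℕ} (hj : j < medianIters n (ε / 4))
    {σ : Fin n → TournamentState (Fin (2 ^ w))}
    (hσ : σ ∈ sparse n P Q (max ((1 - s) * medianSeq (1 / 2 - ε / 4) j) τ)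
      (max ((1 - s) * medianSeq (1 / 2 - ε / 4) j) τ)) :
    (runFrom φ ε K (2 * shiftIters φ ε + 3 * j) σ 3).toOuterMeasure
      (sparse n P Q (max ((1 - s) * medianSeq (1 / 2 - ε / 4) (j + 1)) τ)
        (max ((1 - s) * medianSeq (1 / 2 - ε / 4) (j + 1)) τ))ᶜ ≤ 2 * tailBound n t := by
  have hn : 0 < n := Fin.pos (Classical.arbitrary (Fin n))
  obtain ⟨hbuf, hσP, hσQ⟩ := hσ
  have hr1 : 2 * shiftIters φ ε ≤ 2 * shiftIters φ ε + 3 * j := by omega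
  have hr2 : 2 * shiftIters φ ε + 3 * j + 2 <
    2 * shiftIters φ ε + 3 * medianIters n (ε / 4) := by omega
  have hσv : ∀ v, σ v = ⟨(σ v).val, (σ v).coin, []⟩ := fun v => by rw [← hbuf v]
  obtain ⟨hl0, hl1⟩ := medianSeq_mem (l₀ := 1 / 2 - ε / 4) (by linarith) (by linarith) j
  rw [runFrom_eq_indepPMF]
  · have hset : ∀ R : Set (Fin (2 ^ w)), (∀ a b c, median3 a b c ∈ R ↔
        (a ∈ R ∧ b ∈ R) ∨ (a ∈ R ∧ c ∈ R) ∨ (b ∈ R ∧ c ∈ R)) →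
        frac (fun v => (σ v).val) R ≤ max ((1 - s) * medianSeq (1 / 2 - ε / 4) j) τ →
        ∃ q, 0 ≤ q ∧ q ≤ 1 ∧ q + t ≤ max ((1 - s) * medianSeq (1 / 2 - ε / 4) (j + 1)) τ ∧
        ∀ v, ((localRun φ ε K (2 * shiftIters φ ε + 3 * j) (fun u => (σ u).val) 3
          (σ v)).toOuterMeasure {s | s.val ∈ R}).toReal = q := by
      intro R hR hσR
      have hprob := fun v => prob_localRun_median φ ε K (fun u => (σ u).val) (σ v).val
        (σ v).coin R hr1 hr2 hR
      simp only [← hσv] at hprob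
      refine ⟨_, ?_, ?_, ?_, hprob⟩
      · rw [← hprob (Classical.arbitrary _)]; exact (toReal_toOuterMeasure_mem _ _).1
      · rw [← hprob (Classical.arbitrary _)]; exact (toReal_toOuterMeasure_mem _ _).2
      · exact median_step_le (frac_nonneg _ _) hl0 hl1 hs0 hs1 hτ hτ1 hτ2 hσR
    refine toOuterMeasure_indepPMF_compl_sparse_le _ P Q hn ht0 ht1 ?_ (hset P hP hσP)
      (hset Q hQ hσQ)
    intro v s hs
    rw [hσv v, localRun_median φ ε K _ _ _ hr1 hr2] at hs
    simp only [PMF.mem_support_bind_iff, PMF.mem_support_map_iff] at hs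
    obtain ⟨u₁, -, u₂, -, u₃, -, rfl⟩ := hs
    rfl
  · intro j' hj' v s hs
    rw [hσv v] at hs ⊢
    interval_cases j'
    · simp only [localRun, PMF.mem_support_pure_iff] at hs
      rw [hs]
    · simp only [localRun, PMF.pure_bind, Nat.add_zero] at hs
      rw [localStep_median φ ε K _ _ _ hr1 (by omega)] at hs
      simp only [PMF.mem_support_map_iff] at hs
      obtain ⟨u₁, -, rfl⟩ := hs
      rfl
    · simp only [localRun, PMF.pure_bind, Nat.add_zero] at hs
      rw [localStep_median φ ε K _ _ _ hr1 (by omega), PMF.bind_map] at hs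
      simp only [PMF.mem_support_bind_iff, Function.comp_apply, List.nil_append] at hs
      obtain ⟨u₁, -, hs⟩ := hs
      rw [localStep_median φ ε K _ _ _ (by omega) (by omega)] at hs
      simp only [PMF.mem_support_map_iff] at hs
      obtain ⟨u₂, -, rfl⟩ := hs
      rfl

variable (x : Fin n → Fin (2 ^ w))

theorem config_shift_sparse (h0 : 0 ≤ φ) (h1 : φ ≤ 1) (hε0 : 0 < ε) (hε : ε ≤ 1 / 8)
    (ht0 : 0 ≤ t) (ht1 : t ≤ 1) (hP : ∀ a b, shiftOp φ ε a b ∈ P ↔ a ∈ P ∧ b ∈ P)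
    (hQ : ∀ a b, shiftOp φ ε a b ∈ Q ↔ a ∈ Q ∨ b ∈ Q)
    (hxP : frac x P ≤ shiftTarget φ ε 0 + t)
    (hxQ : frac x Q ≤ max 0 (1 - shiftTarget φ ε 0 - 2 * ε) + t) {i : ℕ}
    (hi : i ≤ shiftIters φ ε) :
    PMF.toOuterMeasure ((tournament n w φ ε K).config x (2 * i))
      (sparse n P Q (shiftTarget φ ε i + (2 ^ (i + 1) - 1) * t)
        (max 0 (1 - shiftTarget φ ε i - 2 * ε) + (2 ^ (i + 1) - 1) * t))ᶜ ≤
      i * (2 * tailBound n t) := by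
  induction i with
  | zero =>
    have hmem : (fun v => (tournament n w φ ε K).init (x v)) ∈
        sparse n P Q (shiftTarget φ ε 0 + (2 ^ (0 + 1) - 1) * t)
        (max 0 (1 - shiftTarget φ ε 0 - 2 * ε) + (2 ^ (0 + 1) - 1) * t) := by
      norm_num
      exact ⟨fun _ => rfl, hxP, hxQ⟩
    change (PMF.pure (fun v => (tournament n w φ ε K).init (x v))).toOuterMeasure _ ≤ _
    rw [PMF.toOuterMeasure_pure_apply, if_neg (fun h => h hmem)]
    exact zero_le
  | succ i ih =>
    have hE : (0 : ℝ) ≤ (2 ^ (i + 1) - 1) * t := by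
      have : (1 : ℝ) ≤ 2 ^ (i + 1) := one_le_pow₀ one_le_two
      exact mul_nonneg (by linarith) ht0
    have hE' : ((2 : ℝ) ^ (i + 1 + 1) - 1) * t = 2 * ((2 ^ (i + 1) - 1) * t) + t := by ring
    rw [hE', show 2 * (i + 1) = 2 * i + 2 by ring, config_add]
    refine (toOuterMeasure_bind_le _ _ _ _ _ fun σ hσ =>
      shift_iteration φ ε K h0 h1 hε0 hε ht0 ht1 hP hQ (by omega) hE hσ).trans ?_
    refine (add_le_add_left (ih (by omega)) _).trans_eq ?_
    push_cast
    ring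

theorem config_median_sparse (hε0 : 0 ≤ ε) (hε : ε ≤ 1 / 2) (ht0 : 0 ≤ t) (ht1 : t ≤ 1)
    (hP : ∀ a b c, median3 a b c ∈ P ↔ (a ∈ P ∧ b ∈ P) ∨ (a ∈ P ∧ c ∈ P) ∨ (b ∈ P ∧ c ∈ P))
    (hQ : ∀ a b c, median3 a b c ∈ Q ↔ (a ∈ Q ∧ b ∈ Q) ∨ (a ∈ Q ∧ c ∈ Q) ∨ (b ∈ Q ∧ c ∈ Q))
    {s τ a : ℝ} (hs0 : 0 ≤ s) (hs1 : s ≤ 1 / 2) (hτ : 0 ≤ τ) (hτ1 : 3 * τ ^ 2 + t ≤ τ)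
    (hτ2 : t ≤ τ ^ 2 * (s / 2)) (ha : a ≤ (1 - s) * (1 / 2 - ε / 4)) {β : ℝ≥0∞}
    (hβ : PMF.toOuterMeasure ((tournament n w φ ε K).config x (2 * shiftIters φ ε))
      (sparse n P Q a a)ᶜ ≤ β) {j : ℕ} (hj : j ≤ medianIters n (ε / 4)) :
    PMF.toOuterMeasure ((tournament n w φ ε K).config x (2 * shiftIters φ ε + 3 * j))
      (sparse n P Q (max ((1 - s) * medianSeq (1 / 2 - ε / 4) j) τ)
        (max ((1 - s) * medianSeq (1 / 2 - ε / 4) j) τ))ᶜ ≤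
      β + j * (2 * tailBound n t) := by
  induction j with
  | zero =>
    refine le_trans (MeasureTheory.measure_mono (Set.compl_subset_compl.2 ?_)) (hβ.trans (by simp))
    rintro σ ⟨h1, h2, h3⟩
    exact ⟨h1, (h2.trans ha).trans (le_max_left _ _), (h3.trans ha).trans (le_max_left _ _)⟩
  | succ j ih =>
    rw [show 2 * shiftIters φ ε + 3 * (j + 1) = 2 * shiftIters φ ε + 3 * j + 3 by ring, config_add]
    refine (toOuterMeasure_bind_le _ _ _ _ _ fun σ hσ =>
      median_iteration φ ε K hε0 hε ht0 ht1 hP hQ hs0 hs1 hτ hτ1 hτ2 (by omega) hσ).trans ?_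
    refine (add_le_add_left (ih (by omega)) _).trans_eq ?_
    push_cast
    ring

open Classical in
/-- The final sampling, when few values lie in `P` or `Q`. The sets are only assumed to contain
the median of a list if they contain half of its members. -/
theorem final_sampling (hP : ∀ (l : List (Fin (2 ^ w))) (d), 0 < l.length → listMedian l d ∈ P →
      l.length ≤ 2 * l.countP (· ∈ P))
    (hQ : ∀ (l : List (Fin (2 ^ w))) (d), 0 < l.length → listMedian l d ∈ Q →
      l.length ≤ 2 * l.countP (· ∈ Q)) (hK : 0 < K)
    {τ : ℝ} (hτ0 : 0 < τ) (hτ1 : τ ≤ 1) {σ : Fin n → TournamentState (Fin (2 ^ w))}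
    (hσ : σ ∈ sparse n P Q τ τ) :
    (runFrom φ ε K (2 * shiftIters φ ε + 3 * medianIters n (ε / 4)) σ K).toOuterMeasure
      {σ | ∃ v, listMedian (σ v).buf (σ v).val ∈ P ∨ listMedian (σ v).buf (σ v).val ∈ Q} ≤
      n * (2 * ENNReal.ofReal ((2 * √τ) ^ K)) := by
  obtain ⟨hbuf, hσP, hσQ⟩ := hσ
  have hσv : ∀ v, σ v = ⟨(σ v).val, (σ v).coin, []⟩ := fun v => by rw [← hbuf v]
  rw [runFrom_eq_indepPMF]
  · have hS := toOuterMeasure_indepPMF_exists_le (fun v => localRun φ ε K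
        (2 * shiftIters φ ε + 3 * medianIters n (ε / 4)) (fun u => (σ u).val) K (σ v))
      {s | listMedian s.buf s.val ∈ P ∨ listMedian s.buf s.val ∈ Q}
      (2 * ENNReal.ofReal ((2 * √τ) ^ K))
    refine hS fun v => ?_
    rw [hσv v, localRun_final φ ε K _ _ _ le_rfl, PMF.toOuterMeasure_map_apply]
    have hsub : ((fun l => (⟨(σ v).val, (σ v).coin, l⟩ : TournamentState (Fin (2 ^ w)))) ⁻¹'
          {s | listMedian s.buf s.val ∈ P ∨ listMedian s.buf s.val ∈ Q}) ∩
          (samples (fun u => (σ u).val) K).support ⊆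
        {s | s.length ≤ 2 * s.countP (· ∈ P)} ∪ {s | s.length ≤ 2 * s.countP (· ∈ Q)} := by
      rintro l ⟨hl, hs⟩
      have hlen := length_of_mem_support_samples _ _ hs
      rcases hl with hl | hl
      · exact Or.inl (hP l _ (by omega) hl)
      · exact Or.inr (hQ l _ (by omega) hl)
    refine (PMF.toOuterMeasure_mono _ hsub).trans ((MeasureTheory.measure_union_le _ _).trans ?_)
    rw [two_mul]
    exact add_le_add (toOuterMeasure_samples_le _ P hτ0 hτ1 hσP K)
      (toOuterMeasure_samples_le _ Q hτ0 hτ1 hσQ K)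
  · intro j _ v s hs
    rw [hσv v, localRun_final φ ε K _ _ _ le_rfl] at hs
    obtain ⟨l, -, rfl⟩ := (PMF.mem_support_map_iff _ _ _).1 hs
    rfl

/-- All values that are ever stored are initial values of nodes. -/
theorem mem_range_of_mem_support_config (r : ℕ) {σ : Fin n → TournamentState (Fin (2 ^ w))}
    (hσ : σ ∈ PMF.support ((tournament n w φ ε K).config x r)) (v : Fin n) :
    (σ v).val ∈ Set.range x ∧ ∀ b ∈ (σ v).buf, b ∈ Set.range x := by
  induction r generalizing σ v with
  | zero =>
    have : σ = fun v => (tournament n w φ ε K).init (x v) := (PMF.mem_support_pure_iff _ _).1 hσ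
    subst this
    exact ⟨⟨v, rfl⟩, fun b hb => absurd hb List.not_mem_nil⟩
  | succ r ih =>
    obtain ⟨ρ, hρ, hσ⟩ := (PMF.mem_support_bind_iff _ _ _).1 hσ
    have hσ' := (congrArg PMF.support (step_eq_indepPMF φ ε K r ρ)).subset hσ
    have hv := mem_support_indepPMF hσ' v
    obtain ⟨a, ha, hv⟩ := (PMF.mem_support_bind_iff _ _ _).1 hv
    obtain ⟨u, -, hv⟩ := (PMF.mem_support_map_iff _ _ _).1 hv
    obtain ⟨hval, hbuf⟩ := ih hρ v
    have hu := (ih hρ u).1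
    have ha' : a.1.val = (ρ v).val ∧ a.1.buf = (ρ v).buf := by
      simp only [tournament] at ha
      split_ifs at ha
      · obtain ⟨b, -, rfl⟩ := (PMF.mem_support_map_iff _ _ _).1 ha
        exact ⟨rfl, rfl⟩
      · have := (PMF.mem_support_pure_iff _ _).1 ha
        subst this
        exact ⟨rfl, rfl⟩
    rw [← ha'.1] at hval
    rw [← ha'.2] at hbuf
    rw [← hv]
    exact receive_mem φ ε K r _ hval hbuf hu

end Phases

/-! ### Failure probability -/

section Failure

variable {n w : ℕ}

theorem prob_eq_one_sub (A : GossipAlgorithm (Fin (2 ^ w)) (Fin (2 ^ w))) (x : Fin n → Fin (2 ^ w))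
    (P : (Fin n → Fin (2 ^ w)) → Prop) :
    A.prob x P = 1 - ((A.config x A.rounds).toOuterMeasure
      {σ | ¬ P fun v => A.output (σ v)}).toReal := by
  have h := toOuterMeasure_add_compl (A.outputs x) {y | P y}
  have h1 : (A.outputs x).toOuterMeasure {y | P y}ᶜ =
      (A.config x A.rounds).toOuterMeasure {σ | ¬ P fun v => A.output (σ v)} := by
    rw [GossipAlgorithm.outputs, PMF.toOuterMeasure_map_apply]
    rfl
  have hne : ∀ S, (A.outputs x).toOuterMeasure S ≠ ⊤ := fun S =>
    ne_top_of_le_ne_top ENNReal.one_ne_top (toOuterMeasure_le_one _ S)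
  have h2 := congrArg ENNReal.toReal h
  rw [ENNReal.toReal_add (hne _) (hne _), h1, ENNReal.toReal_one] at h2
  rw [GossipAlgorithm.prob]
  linarith

/-- The failure probability, in terms of the fluctuation `t` allowed in each iteration and of
the fraction `τ` of bad values at the end of the median phase. -/
theorem tournament_failure_le {φ ε ε' : ℝ} {K : ℕ} {t τ : ℝ} (hn : 0 < n) (h0 : 0 ≤ φ)
    (h1 : φ ≤ 1) (hε0 : 0 < ε) (hε : ε ≤ 1 / 8) (hε' : ε ≤ ε') (hεn : 1 ≤ 2 * ε * n)
    (ht1 : t ≤ 1) (hnt : 1 / n ≤ t) (htε : 8 * t ≤ ε ^ 2) (hτ0 : 0 < τ) (hτ1 : τ ≤ 1)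
    (hτt : 3 * τ ^ 2 + t ≤ τ) (hτε : t ≤ τ ^ 2 * (ε / 8)) (hτn : 1 / (n : ℝ) ^ (1 / 3 : ℝ) ≤ τ)
    (hmed : ∃ i, medianSeq (1 / 2 - ε / 4) i ≤ 1 / (n : ℝ) ^ (1 / 3 : ℝ)) (hK : 0 < K)
    (x : Fin n → Fin (2 ^ w)) :
    PMF.toOuterMeasure ((tournament n w φ ε K).config x (tournament n w φ ε K).rounds)
      {σ | ¬ ∀ v, IsApproxQuantile x φ ε' ((tournament n w φ ε K).output (σ v))} ≤
      (shiftIters φ ε + medianIters n (ε / 4) : ℕ) * (2 * tailBound n t) +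
        n * (2 * ENNReal.ofReal ((2 * √τ) ^ K)) := by
  classical
  have : Nonempty (Fin n) := ⟨⟨0, hn⟩⟩
  have hn' : (0 : ℝ) < n := by exact_mod_cast hn
  have ht0 : 0 ≤ t := (by positivity : (0 : ℝ) ≤ 1 / n).trans hnt
  have hH := isUpperSet_tooHigh x φ ε
  have hL := isLowerSet_tooLow x φ ε
  have hxH := frac_tooHigh_le x φ ε hn
  have hxL := frac_tooLow_le x φ ε hn
  -- It does not matter which of the two bad sets shrinks in the shifting phase.
  obtain ⟨P, Q, hPQ, hP, hQ, hxP, hxQ⟩ : ∃ P Q : Set (Fin (2 ^ w)),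
      (P = tooHigh x φ ε ∧ Q = tooLow x φ ε ∨ P = tooLow x φ ε ∧ Q = tooHigh x φ ε) ∧
      (∀ a b, shiftOp φ ε a b ∈ P ↔ a ∈ P ∧ b ∈ P) ∧
      (∀ a b, shiftOp φ ε a b ∈ Q ↔ a ∈ Q ∨ b ∈ Q) ∧
      frac x P ≤ shiftTarget φ ε 0 + t ∧
      frac x Q ≤ max 0 (1 - shiftTarget φ ε 0 - 2 * ε) + t := by
    rw [shiftTarget_zero h0 h1 hε0 hε]
    by_cases hs : ShiftsByMin φ ε
    · have hs' := shiftsByMin_iff.1 hs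
      refine ⟨tooHigh x φ ε, tooLow x φ ε, Or.inl ⟨rfl, rfl⟩, ?_, ?_, ?_, ?_⟩
      · intro a b; rw [shiftOp, if_pos hs, hH.min_mem_iff]
      · intro a b; rw [shiftOp, if_pos hs, hL.min_mem_iff]
      · rw [max_eq_right (by linarith)] at hxH
        rw [shiftStart, if_pos hs]; linarith
      · rw [shiftStart, if_pos hs, show 1 - (1 - (φ + ε)) - 2 * ε = φ - ε by ring]
        linarith
    · have hs' := mt shiftsByMin_iff.2 hs
      rw [not_le] at hs'
      refine ⟨tooLow x φ ε, tooHigh x φ ε, Or.inr ⟨rfl, rfl⟩, ?_, ?_, ?_, ?_⟩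
      · intro a b; rw [shiftOp, if_neg hs, hL.max_mem_iff]
      · intro a b; rw [shiftOp, if_neg hs, hH.max_mem_iff]
      · rw [max_eq_right (by linarith)] at hxL
        rw [shiftStart, if_neg hs]; linarith
      · rw [shiftStart, if_neg hs, show 1 - (φ - ε) - 2 * ε = 1 - (φ + ε) by ring]
        linarith
  have hPmed : ∀ a b c,
      median3 a b c ∈ P ↔ (a ∈ P ∧ b ∈ P) ∨ (a ∈ P ∧ c ∈ P) ∨ (b ∈ P ∧ c ∈ P) := by
    rcases hPQ with ⟨rfl, -⟩ | ⟨rfl, -⟩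
    exacts [hH.median3_mem_iff, hL.median3_mem_iff]
  have hQmed : ∀ a b c,
      median3 a b c ∈ Q ↔ (a ∈ Q ∧ b ∈ Q) ∨ (a ∈ Q ∧ c ∈ Q) ∨ (b ∈ Q ∧ c ∈ Q) := by
    rcases hPQ with ⟨-, rfl⟩ | ⟨-, rfl⟩
    exacts [hL.median3_mem_iff, hH.median3_mem_iff]
  have hPlist : ∀ (l : List (Fin (2 ^ w))) (d), 0 < l.length → listMedian l d ∈ P →
      l.length ≤ 2 * l.countP (· ∈ P) := by
    rcases hPQ with ⟨rfl, -⟩ | ⟨rfl, -⟩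
    exacts [fun _ _ h => listMedian_mem_imp_upper hH h, fun _ _ h => listMedian_mem_imp_lower hL h]
  have hQlist : ∀ (l : List (Fin (2 ^ w))) (d), 0 < l.length → listMedian l d ∈ Q →
      l.length ≤ 2 * l.countP (· ∈ Q) := by
    rcases hPQ with ⟨-, rfl⟩ | ⟨-, rfl⟩
    exacts [fun _ _ h => listMedian_mem_imp_lower hL h, fun _ _ h => listMedian_mem_imp_upper hH h]
  -- After the shifting phase both bad sets are at least `ε / 2` below one half.
  have hshift := config_shift_sparse φ ε K x h0 h1 hε0 hε ht0 ht1 hP hQ hxP hxQ le_rfl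
  have hE : ((2 : ℝ) ^ (shiftIters φ ε + 1) - 1) * t ≤ ε / 2 := by
    have h2 := two_pow_shiftIters_le h0 h1 hε0 hε
    rw [le_div_iff₀ hε0] at h2
    have h3 : (2 : ℝ) ^ shiftIters φ ε * (8 * t) ≤ 2 ^ shiftIters φ ε * ε ^ 2 := by gcongr
    rw [pow_succ]
    nlinarith
  have hT : shiftTarget φ ε (shiftIters φ ε) = 1 / 2 - ε := by simp [shiftTarget]
  have hshift' : PMF.toOuterMeasure ((tournament n w φ ε K).config x (2 * shiftIters φ ε))
      (sparse n P Q (1 / 2 - ε / 2) (1 / 2 - ε / 2))ᶜ ≤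
        shiftIters φ ε * (2 * tailBound n t) := by
    refine le_trans (MeasureTheory.measure_mono (Set.compl_subset_compl.2 ?_)) hshift
    rintro σ ⟨hb, hσP, hσQ⟩
    rw [hT] at hσP hσQ
    rw [max_eq_right (by linarith)] at hσQ
    exact ⟨hb, by linarith, by linarith⟩
  -- The relative slack `ε / 4` below the target sizes of the median phase fits in that gap.
  have hmedian := config_median_sparse φ ε K x hε0.le (by linarith) ht0 ht1 hPmed hQmed
    (s := ε / 4) (a := 1 / 2 - ε / 2) (by linarith) (by linarith) hτ0.le hτt
    (by linarith) (by nlinarith) hshift' le_rfl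
  have hmem : medianSeq (1 / 2 - ε / 4) (medianIters n (ε / 4)) ≤ 1 / (n : ℝ) ^ (1 / 3 : ℝ) :=
    Nat.sInf_mem (s := {i | medianSeq (1 / 2 - ε / 4) i ≤ 1 / (n : ℝ) ^ (1 / 3 : ℝ)}) hmed
  have hl0 := (medianSeq_mem (l₀ := 1 / 2 - ε / 4) (by linarith) (by linarith)
    (medianIters n (ε / 4))).1
  rw [max_eq_right (by nlinarith)] at hmedian
  have hfinal := toOuterMeasure_bind_le
    ((tournament n w φ ε K).config x (2 * shiftIters φ ε + 3 * medianIters n (ε / 4)))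
    (fun σ => runFrom φ ε K (2 * shiftIters φ ε + 3 * medianIters n (ε / 4)) σ K) _ _ _
    fun σ hσ => final_sampling φ ε K hPlist hQlist hK hτ0 hτ1 hσ
  rw [← config_add] at hfinal
  calc _ ≤ PMF.toOuterMeasure ((tournament n w φ ε K).config x (tournament n w φ ε K).rounds)
        {σ | ∃ v, listMedian (TournamentState.buf (σ v)) (TournamentState.val (σ v)) ∈ P ∨
          listMedian (TournamentState.buf (σ v)) (TournamentState.val (σ v)) ∈ Q} := by
        refine PMF.toOuterMeasure_mono _ ?_
        rintro σ ⟨hσ, hs⟩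
        by_contra hgood
        refine hσ fun v => ?_
        have hv : ∀ R, R = P ∨ R = Q →
            listMedian (TournamentState.buf (σ v)) (TournamentState.val (σ v)) ∉ R := by
          rintro R (rfl | rfl) h
          exacts [hgood ⟨v, Or.inl h⟩, hgood ⟨v, Or.inr h⟩]
        obtain ⟨hr1, hr2⟩ := mem_range_of_mem_support_config φ ε K x _ hs v
        refine (isApproxQuantile_of_notMem hεn (by positivity) (listMedian_mem_range hr1 hr2)
          (hv _ ?_) (hv _ ?_)).mono hε'
        · rcases hPQ with ⟨rfl, rfl⟩ | ⟨rfl, rfl⟩ <;> simp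
        · rcases hPQ with ⟨rfl, rfl⟩ | ⟨rfl, rfl⟩ <;> simp
    _ ≤ _ := hfinal
    _ ≤ _ := by
        rw [Nat.cast_add, add_mul]
        exact add_le_add_left hmedian _

end Failure

/-! ### Number of rounds -/

section NumberOfRounds

variable {φ ε : ℝ}

theorem shiftIters_le (h0 : 0 ≤ φ) (h1 : φ ≤ 1) (hε0 : 0 < ε) (hε : ε ≤ 1 / 8) :
    (shiftIters φ ε : ℝ) ≤ 2 * Real.log (1 / ε) + 1 := by
  have h2 := Real.log_le_log (by positivity) (two_pow_shiftIters_le h0 h1 hε0 hε)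
  rw [Real.log_pow, show 2 / ε = 2 * (1 / ε) by ring,
    Real.log_mul (by norm_num) (by positivity)] at h2
  have h3 : 1 / 2 ≤ Real.log 2 := by linarith [Real.log_two_gt_d9]
  have h4 : 0 ≤ Real.log (1 / ε) := Real.log_nonneg (by rw [le_div_iff₀ hε0]; linarith)
  have h5 : ((shiftIters φ ε : ℝ) - 1) * Real.log 2 ≤ Real.log (1 / ε) := by linarith
  by_contra h
  push Not at h
  nlinarith

/-- The distance of the target from one half grows geometrically until the target is at most
`1 / 4`, which takes `O(log (1 / ε))` iterations; from then on it decreases doubly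
exponentially. -/
theorem exists_medianSeq_le {n : ℕ} (hε0 : 0 < ε) (hε : ε ≤ 1 / 8) (hn : 1 ≤ Real.log n) :
    ∃ i : ℕ, medianSeq (1 / 2 - ε / 4) i ≤ 1 / (n : ℝ) ^ (1 / 3 : ℝ) ∧
      (i : ℝ) ≤ 4 * Real.log (1 / ε) + 2 * Real.log (Real.log n) + 4 := by
  have hn0 : (0 : ℝ) < n := by
    rcases Nat.eq_zero_or_pos n with rfl | h
    · norm_num at hn
    · exact_mod_cast h
  have hL : 0 ≤ Real.log (1 / ε) := Real.log_nonneg (by rw [le_div_iff₀ hε0]; linarith)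
  have hll : 0 ≤ Real.log (Real.log n) := Real.log_nonneg hn
  refine ⟨⌈4 * Real.log (1 / ε)⌉₊ + ⌈2 * Real.log (2 * Real.log n)⌉₊,
    medianSeq_le_of_le (by linarith) (by linarith) ?_ ?_, ?_⟩
  · have h2 : 1 / 4 ≤ Real.log (11 / 8) := by
      have := Real.one_sub_inv_le_log_of_pos (x := 11 / 8) (by norm_num)
      norm_num at this ⊢; linarith
    have h3 : 1 / ε ≤ (11 / 8) ^ ⌈4 * Real.log (1 / ε)⌉₊ := by
      rw [← Real.log_le_log_iff (by positivity) (by positivity), Real.log_pow]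
      have := Nat.le_ceil (4 * Real.log (1 / ε))
      nlinarith
    rw [div_le_iff₀ hε0] at h3
    linarith
  · have h2 : 1 / 4 ≤ Real.log (4 / 3) := by
      have := Real.one_sub_inv_le_log_of_pos (x := 4 / 3) (by norm_num)
      norm_num at this ⊢; linarith
    have h3 : 2 * Real.log n ≤ 2 ^ ⌈2 * Real.log (2 * Real.log n)⌉₊ := by
      rw [← Real.log_le_log_iff (by linarith) (by positivity), Real.log_pow]
      have := Nat.le_ceil (2 * Real.log (2 * Real.log n))
      have h5 : 1 / 2 ≤ Real.log 2 := by linarith [Real.log_two_gt_d9]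
      have h6 : 0 ≤ Real.log (2 * Real.log n) := Real.log_nonneg (by linarith)
      nlinarith
    have h4 : (n : ℝ) ^ (1 / 3 : ℝ) ≤
        (4 / 3) ^ 2 ^ ⌈2 * Real.log (2 * Real.log n)⌉₊ := by
      rw [← Real.log_le_log_iff (by positivity) (by positivity), Real.log_pow,
        Real.log_rpow hn0]
      push_cast
      nlinarith
    rw [show (3 / 4 : ℝ) = 1 / (4 / 3) by norm_num, one_div_pow]
    exact one_div_le_one_div_of_le (by positivity) h4
  · have h2 := Nat.ceil_lt_add_one (a := 4 * Real.log (1 / ε)) (by linarith)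
    have h3 := Nat.ceil_lt_add_one (a := 2 * Real.log (2 * Real.log n)) (by
      have := Real.log_nonneg (x := 2 * Real.log n) (by linarith)
      linarith)
    have h4 : Real.log (2 * Real.log n) ≤ 1 + Real.log (Real.log n) := by
      rw [Real.log_mul (by norm_num) (by linarith)]
      linarith [Real.log_two_lt_d9]
    push_cast
    linarith

theorem medianIters_le {n : ℕ} (hε0 : 0 < ε) (hε : ε ≤ 1 / 8) (hn : 1 ≤ Real.log n) :
    (medianIters n (ε / 4) : ℝ) ≤ 4 * Real.log (1 / ε) + 2 * Real.log (Real.log n) + 4 := by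
  obtain ⟨i, hi, hi'⟩ := exists_medianSeq_le hε0 hε hn
  have : medianIters n (ε / 4) ≤ i :=
    Nat.sInf_le (show i ∈ {i | medianSeq (1 / 2 - ε / 4) i ≤ 1 / (n : ℝ) ^ (1 / 3 : ℝ)} from hi)
  have : (medianIters n (ε / 4) : ℝ) ≤ i := by exact_mod_cast this
  linarith

end NumberOfRounds

/-! ### Choice of the parameters -/

section Parameters

/-- With `n = m ^ 10` and accuracy at least `1 / m`, the fluctuations allowed are `m ^ (-4)`, the
fraction of each kind of bad values before the final sampling is `1 / m`, and half of `K` samples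
are bad of that kind with probability at most `(4 / m) ^ (K / 2)`. -/
theorem tournament_prob_ge {n w K : ℕ} {φ ε ε' m γ : ℝ} (hm : 8 ≤ m) (hnm : (n : ℝ) = m ^ 10)
    (h0 : 0 ≤ φ) (h1 : φ ≤ 1) (hmε : 1 / m ≤ ε) (hε : ε ≤ 1 / 8) (hε' : ε ≤ ε')
    (hlog : 1 ≤ Real.log n) (hiter : 3 * Real.log n + 5 ≤ n)
    (hexp : m ^ (10 * γ + 10) * Real.exp (-(1 / 4) * m) ≤ 1 / 4)
    (hK : 20 * (γ + 2) ≤ K) (hK0 : 0 < K) (hKn : (2 : ℝ) ^ (K + 2) ≤ n) (x : Fin n → Fin (2 ^ w)) :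
    1 - (n : ℝ) ^ (-γ) ≤
      (tournament n w φ ε K).prob x fun y => ∀ v, IsApproxQuantile x φ ε' (y v) := by
  have hm0 : 0 < m := by linarith
  have hε0 : 0 < ε := (by positivity : 0 < 1 / m).trans_le hmε
  have hn0 : (0 : ℝ) < n := by rw [hnm]; positivity
  have hn : 0 < n := by exact_mod_cast hn0
  have hinv : m * (1 / m) = 1 := by field_simp
  have hinv8 : 1 / m ≤ 1 / 8 := one_div_le_one_div_of_le (by norm_num) hm
  have hτ0 : 0 < 1 / m := by positivity
  set τ : ℝ := 1 / m with hτ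
  have hτpow : 8 * τ ^ 4 ≤ τ ^ 3 := by
    have : 8 * τ ≤ 1 := by linarith
    nlinarith [pow_pos hτ0 3]
  obtain ⟨i, hi, -⟩ := exists_medianSeq_le hε0 hε hlog
  have hfail := tournament_failure_le (w := w) (t := τ ^ 4) (τ := τ) hn h0 h1 hε0 hε hε' (K := K)
    (by
      have : 1 ≤ m * ε := by rw [← hinv]; gcongr
      have h9 : 1 ≤ m ^ 9 := one_le_pow₀ (by linarith)
      rw [hnm]
      nlinarith)
    (pow_le_one₀ hτ0.le (by linarith))
    (by
      rw [hnm, hτ, one_div_pow]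
      exact one_div_le_one_div_of_le (by positivity) (pow_le_pow_right₀ (by linarith) (by norm_num)))
    (by
      have : τ ^ 2 ≤ ε ^ 2 := by gcongr
      have : 8 * τ ≤ 1 := by linarith
      nlinarith [pow_pos hτ0 2])
    hτ0 (by linarith)
    (by nlinarith [pow_pos hτ0 2])
    (by
      have : τ ^ 3 ≤ τ ^ 2 * ε := by
        rw [pow_succ]; gcongr
      linarith)
    (by
      refine one_div_le_one_div_of_le hm0 ?_
      rw [hnm, ← Real.rpow_natCast m 10, ← Real.rpow_mul hm0.le]
      nth_rewrite 1 [← Real.rpow_one m]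
      exact Real.rpow_le_rpow_of_exponent_le (by linarith) (by norm_num))
    ⟨i, hi⟩ hK0 x
  rw [prob_eq_one_sub]
  have hbound : ((shiftIters φ ε + medianIters n (ε / 4) : ℕ) : ℝ≥0∞) * (2 * tailBound n (τ ^ 4)) +
      n * (2 * ENNReal.ofReal ((2 * √τ) ^ K)) ≤ ENNReal.ofReal ((n : ℝ) ^ (-γ)) := by
    have hit : ((shiftIters φ ε + medianIters n (ε / 4) : ℕ) : ℝ) ≤ n := by
      have h2 := shiftIters_le h0 h1 hε0 hε
      have h3 := medianIters_le hε0 hε hlog (n := n)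
      have h4 : Real.log (1 / ε) ≤ 1 / 10 * Real.log n := by
        rw [hnm, Real.log_pow]
        have : Real.log (1 / ε) ≤ Real.log m :=
          Real.log_le_log (by positivity) (by
            rw [div_le_iff₀ hε0, ← hinv]; gcongr)
        push_cast
        linarith
      have h5 := Real.log_le_sub_one_of_pos (x := Real.log n) (by linarith)
      push_cast
      linarith
    have hγ : (n : ℝ) ^ γ = m ^ (10 * γ) := by
      rw [hnm, ← Real.rpow_natCast m 10, ← Real.rpow_mul hm0.le]; norm_num
    have hnγ : 0 < (n : ℝ) ^ γ := by positivity
    have hneg : (n : ℝ) ^ (-γ) = 1 / (n : ℝ) ^ γ := by rw [Real.rpow_neg hn0.le, one_div]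
    have hfirst : n * (2 * Real.exp (-(n * (τ ^ 4) ^ 2 / 4))) ≤ (n : ℝ) ^ (-γ) / 2 := by
      have h2 : (n : ℝ) * (τ ^ 4) ^ 2 = m ^ 2 := by
        rw [hnm, hτ]; field_simp
      have h3 : Real.exp (-(m ^ 2 / 4)) ≤ Real.exp (-(1 / 4) * m) := by
        apply Real.exp_le_exp.2; nlinarith
      rw [h2, hneg, div_div, le_div_iff₀ (by positivity), hγ]
      rw [Real.rpow_add hm0, show (10 : ℝ) = ((10 : ℕ) : ℝ) by norm_num, Real.rpow_natCast,
        ← hnm] at hexp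
      push_cast at hexp
      have h4 : 0 ≤ m ^ (10 * γ) * n := by positivity
      nlinarith [mul_le_mul_of_nonneg_left h3 h4]
    have hsecond : n * (2 * (2 * √τ) ^ K) ≤ (n : ℝ) ^ (-γ) / 2 := by
      have h2 : √τ ^ K ≤ (n : ℝ) ^ (-(γ + 2)) := by
        rw [hτ, one_div, Real.sqrt_eq_rpow, ← Real.rpow_natCast, Real.inv_rpow hm0.le,
          ← Real.rpow_neg hm0.le, ← Real.rpow_mul hm0.le, hnm, ← Real.rpow_natCast m 10,
          ← Real.rpow_mul hm0.le]
        refine Real.rpow_le_rpow_of_exponent_le (by linarith) ?_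
        push_cast
        linarith
      have h3 : (n : ℝ) ^ (-(γ + 2)) = (n : ℝ) ^ (-γ) / n ^ 2 := by
        rw [show -(γ + 2) = -γ - (2 : ℕ) by push_cast; ring, Real.rpow_sub_natCast hn0.ne']
      rw [h3] at h2
      calc n * (2 * (2 * √τ) ^ K) = n * 2 ^ (K + 2) / 2 * √τ ^ K := by rw [mul_pow]; ring
        _ ≤ n * n / 2 * ((n : ℝ) ^ (-γ) / n ^ 2) := by gcongr
        _ = (n : ℝ) ^ (-γ) / 2 := by field_simp
    calc _ ≤ (n : ℝ≥0∞) * (2 * tailBound n (τ ^ 4)) + n * (2 * ENNReal.ofReal ((2 * √τ) ^ K)) := by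
          gcongr
          exact_mod_cast hit
      _ = ENNReal.ofReal (n * (2 * Real.exp (-(n * (τ ^ 4) ^ 2 / 4))) +
            n * (2 * (2 * √τ) ^ K)) := by
          rw [ENNReal.ofReal_add (by positivity) (by positivity), ENNReal.ofReal_mul hn0.le,
            ENNReal.ofReal_mul hn0.le, ENNReal.ofReal_mul (by norm_num),
            ENNReal.ofReal_mul (by norm_num), ENNReal.ofReal_natCast, ENNReal.ofReal_ofNat,
            tailBound]
      _ ≤ _ := ENNReal.ofReal_le_ofReal (by linarith)
  have hreal := ENNReal.toReal_mono ENNReal.ofReal_ne_top (hfail.trans hbound)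
  rw [ENNReal.toReal_ofReal (by positivity)] at hreal
  linarith

end Parameters

/-- There is an absolute constant `C` such that for every desired exponent `γ` of the error
probability there is a sample size `K = O(1)` for the last step with the following property. For
every accuracy `ε(n) = Ω(n ^ (-0.096))`, all large `n`, every `φ ∈ [0, 1]` and every word length
`w = O(log n)` of the values, the tournament algorithm takes at most `C (log log n + log (1 / ε))`
rounds, its messages have `O(log n)` bits, and, whatever the values of the nodes, with probability
at least `1 - n ^ (-γ)` every node outputs an `ε`-approximate `φ`-quantile. -/
theorem mainTheorem5 :
    ∃ C : ℝ, 0 < C ∧ ∀ γ : ℝ, 0 < γ → ∃ K : ℕ,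
      ∀ ε : ℕ → ℝ, (∀ n, 0 < ε n ∧ ε n ≤ 1) →
      (fun n : ℕ => (n : ℝ) ^ (-0.096 : ℝ)) =O[Filter.atTop] ε →
      ∀ᶠ n : ℕ in Filter.atTop,
      ∀ φ : ℝ, 0 ≤ φ → φ ≤ 1 →
      ∀ (B : ℝ) (w : ℕ), (w : ℝ) ≤ B * Real.log n →
        ((tournament n w φ (min (ε n) (1 / 8)) K).rounds : ℝ)
            ≤ C * (Real.log (Real.log n) + Real.log (1 / ε n)) ∧
        ((tournament n w φ (min (ε n) (1 / 8)) K).messageBits : ℝ) ≤ B * Real.log n ∧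
        ∀ x : Fin n → Fin (2 ^ w),
          1 - (n : ℝ) ^ (-γ) ≤
            (tournament n w φ (min (ε n) (1 / 8)) K).prob x
              fun y => ∀ v, IsApproxQuantile x φ (ε n) (y v) := by
  refine ⟨16, by norm_num, fun γ hγ => ⟨⌈20 * (γ + 2)⌉₊, fun ε hε hO => ?_⟩⟩
  set K := ⌈20 * (γ + 2)⌉₊ with hKdef
  have hcast : Filter.Tendsto (fun n : ℕ => (n : ℝ)) Filter.atTop Filter.atTop :=
    tendsto_natCast_atTop_atTop
  have hm : Filter.Tendsto (fun n : ℕ => (n : ℝ) ^ (1 / 10 : ℝ)) Filter.atTop Filter.atTop :=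
    (tendsto_rpow_atTop (by norm_num)).comp hcast
  have hlog : Filter.Tendsto (fun n : ℕ => Real.log n) Filter.atTop Filter.atTop :=
    Real.tendsto_log_atTop.comp hcast
  have hloglog : Filter.Tendsto (fun n : ℕ => Real.log (Real.log n)) Filter.atTop Filter.atTop :=
    Real.tendsto_log_atTop.comp hlog
  have hexp := (tendsto_rpow_mul_exp_neg_mul_atTop_nhds_zero (10 * γ + 10) (1 / 4)
    (by norm_num)).comp hm
  -- The exponent `0.096` is below `1 / 10`, hence eventually `ε n ≥ n ^ (-1 / 10)`.
  obtain ⟨c, hc0, hc⟩ := hO.exists_pos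
  have hgap : Filter.Tendsto (fun n : ℕ => (n : ℝ) ^ (1 / 250 : ℝ)) Filter.atTop Filter.atTop :=
    (tendsto_rpow_atTop (by norm_num)).comp hcast
  have hsmall : ∀ᶠ n : ℕ in Filter.atTop, 3 * Real.log n + 5 ≤ n := by
    have h1 := (Real.isLittleO_log_id_atTop.comp_tendsto hcast).bound
      (show (0 : ℝ) < 1 / 6 by norm_num)
    filter_upwards [h1, hcast.eventually_ge_atTop 10, hlog.eventually_ge_atTop 0] with n h1 h2 h3
    simp only [Function.comp_apply, id, Real.norm_eq_abs, abs_of_nonneg h3] at h1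
    rw [abs_of_nonneg (by linarith)] at h1
    linarith
  filter_upwards [hc.bound, hgap.eventually_ge_atTop c, hm.eventually_ge_atTop 8,
    hloglog.eventually_ge_atTop ((62 + K) / 10), hlog.eventually_ge_atTop 1, hsmall,
    hexp.eventually_le_const (show (0 : ℝ) < 1 / 4 by norm_num),
    hcast.eventually_ge_atTop (2 ^ (K + 2))] with n hO hgap hm hll hlog hsmall hexp hKn
  intro φ h0 h1 B w hw
  obtain ⟨hε0, hε1⟩ := hε n
  have hn0 : (0 : ℝ) < n := lt_of_lt_of_le (by positivity) hKn
  have hmin0 : 0 < min (ε n) (1 / 8) := lt_min hε0 (by norm_num)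
  have hmin8 : min (ε n) (1 / 8) ≤ 1 / 8 := min_le_right _ _
  refine ⟨?_, hw, fun x => ?_⟩
  · have h2 := shiftIters_le h0 h1 hmin0 hmin8
    have h3 := medianIters_le hmin0 hmin8 hlog
    have h4 : Real.log (1 / min (ε n) (1 / 8)) ≤ Real.log (1 / ε n) + 3 := by
      have h5 : 1 / min (ε n) (1 / 8) ≤ 1 / ε n * 8 := by
        rw [div_le_iff₀ hmin0]
        rcases min_choice (ε n) (1 / 8) with h | h <;> rw [h]
        · rw [mul_right_comm, one_div_mul_cancel hε0.ne']; norm_num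
        · rw [mul_assoc]; norm_num
          exact (one_le_inv₀ hε0).2 hε1
      refine (Real.log_le_log (by positivity) h5).trans ?_
      rw [Real.log_mul (by positivity) (by norm_num), show (8 : ℝ) = 2 ^ 3 by norm_num,
        Real.log_pow]
      push_cast
      linarith [Real.log_two_lt_d9]
    have h6 : ((tournament n w φ (min (ε n) (1 / 8)) K).rounds : ℝ) =
        2 * shiftIters φ (min (ε n) (1 / 8)) + 3 * medianIters n (min (ε n) (1 / 8) / 4) + K := by
      simp [tournament]
    rw [h6]
    linarith
  · refine tournament_prob_ge hm ?_ h0 h1 (le_min ?_ ?_) hmin8 (min_le_left _ _) hlog hsmall hexp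
      (Nat.le_ceil _) (Nat.ceil_pos.2 (by linarith)) hKn x
    · rw [← Real.rpow_natCast, ← Real.rpow_mul hn0.le]
      norm_num
    · rw [Real.norm_of_nonneg (by positivity), Real.norm_of_nonneg hε0.le] at hO
      have h2 : (n : ℝ) ^ (-0.096 : ℝ) = n ^ (1 / 250 : ℝ) * (1 / (n : ℝ) ^ (1 / 10 : ℝ)) := by
        rw [one_div ((n : ℝ) ^ (1 / 10 : ℝ)), ← Real.rpow_neg hn0.le, ← Real.rpow_add hn0]
        norm_num
      rw [h2] at hO
      have h3 : c * (1 / (n : ℝ) ^ (1 / 10 : ℝ)) ≤ c * ε n :=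
        (mul_le_mul_of_nonneg_right hgap (by positivity)).trans hO
      exact le_of_mul_le_mul_left h3 hc0
    · exact one_div_le_one_div_of_le (by norm_num) hm
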